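/- Let $X=(X_t)_{t\ge 0}$ be a spectrally positive Lévy process on $\mathbb R$ whose paths are not almost surely of locally bounded variation; thus $\mathbb E e^{i\xi X_t}=e^{-t\psi(\xi)}$ with $$\psi(\xi)=\sigma^2\xi^2-i\xi b-\int_{(0,\infty)}\big(e^{i\xi x}-1-i\xi x\mathbf 1_{x<1}\big)\,\nu(dx),$$ where $\sigma\ge 0$, $b\in\mathbb R$ and $\nu$ is a measure on $(0,\infty)$ with $\int(1\wedge x^2)\,\nu(dx)<\infty$. Let $\varphi$ be its Laplace exponent, $\mathbb E e^{-\lambda X_t}=e^{t\varphi(\lambda)}$ for $\lambda\ge 0$; let $\theta_0\ge 0$ be the largest root of $\varphi$ on $[0,\infty)$ and $\theta_1=\inf\{s>0:\varphi'(s)>0\}$. Suppose that there are $\alpha>1$, $c\in(0,1]$ and $x_0\ge 0$ such that $\varphi''(\lambda x)\ge c\lambda^{\alpha-2}\varphi''(x)$ for all $\lambda\ge 1$ and $x>x_0$, and that $\varphi'(\theta_1)=0$ (understood as the right derivative if $\theta_1=0$). Then for every $t>0$ the law of $X_t$ has a continuous density $p(t,\cdot)$, and there are constants $M>0$ and $C\ge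 1$ such that for all $t>0$ and $x\in\mathbb R$ with $$-x\,\varphi^{-1}(1/t)>M\quad\text{and}\quad 0\le t\,\varphi(x_0\vee 2\theta_0)\le 1,$$ the number $w=(\varphi')^{-1}(-x/t)>0$ is well defined, $\varphi'(w)=-x/t$, and $$C^{-1}\,\frac{\exp\{-t(w\varphi'(w)-\varphi(w))\}}{\sqrt{t\varphi''(w)}}\le p(t,x)\le C\,\frac{\exp\{-t(w\varphi'(w)-\varphi(w))\}}{\sqrt{t\varphi''(w)}} .$$ Here $\varphi^{-1}(1/t)$ and $(\varphi')^{-1}(-x/t)$ denote the positive solutions $r$ of $\varphi(r)=1/t$ and of $\varphi'(r)=-x/t$, respectively. -/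

import Mathlib

open MeasureTheory ProbabilityTheory Filter Topology Set
open scoped NNReal ENNReal

noncomputable section

namespace SpecPos

variable {Ω : Type*} [MeasurableSpace Ω]

/-- A real Lévy process: started at `0`, with independent and stationary increments and almost
surely càdlàg paths. -/
structure IsLevyProcess (X : ℝ≥0 → Ω → ℝ) (P : Measure Ω) : Prop where
  measurable : ∀ t, Measurable (X t)
  zero : ∀ᵐ ω ∂P, X 0 ω = 0
  indep : HasIndepIncrements X P
  stationary : ∀ s t, P.map (X (s + t) - X s) = P.map (X t)
  cadlag : ∀ᵐ ω ∂P, ∀ t, ContinuousWithinAt (fun s => X s ω) (Ici t) t ∧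
    ∃ l, Tendsto (fun s => X s ω) (𝓝[<] t) (𝓝 l)

/-- `ν` is a Lévy measure living on `(0, ∞)`. -/
structure IsPosLevyMeasure (ν : Measure ℝ) : Prop where
  nonpos_null : ν (Iic 0) = 0
  lintegral_lt_top : ∫⁻ x in Ioi 0, ENNReal.ofReal (min 1 (x ^ 2)) ∂ν < ⊤

/-- The characteristic (Lévy-Khintchine) exponent
`ψ(ξ) = σ²ξ² - iξb - ∫_{(0,∞)} (e^{iξx} - 1 - iξx 1_{x<1}) ν(dx)`. -/
def charExponent (σ b : ℝ) (ν : Measure ℝ) (ξ : ℝ) : ℂ :=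
  (σ : ℂ) ^ 2 * (ξ : ℂ) ^ 2 - Complex.I * ξ * b -
    ∫ x in Ioi (0 : ℝ), (Complex.exp (Complex.I * ξ * x) - 1 -
      Complex.I * ξ * (if x < 1 then (x : ℂ) else 0)) ∂ν

/-- `X` is a spectrally positive Lévy process with Gaussian coefficient `σ`, drift `b` and Lévy
measure `ν` on `(0, ∞)`, that is, `𝔼 e^{iξX_t} = e^{-tψ(ξ)}`. -/
structure IsSpectrallyPositiveLevy (X : ℝ≥0 → Ω → ℝ) (P : Measure Ω)
    (σ b : ℝ) (ν : Measure ℝ) : Prop extends IsLevyProcess X P where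
  sigma_nonneg : 0 ≤ σ
  levyMeasure : IsPosLevyMeasure ν
  charFun_eq : ∀ (t : ℝ≥0) (ξ : ℝ),
    charFun (P.map (X t)) ξ = Complex.exp (-((t : ℝ) : ℂ) * charExponent σ b ν ξ)

/-- `X` is of unbounded variation: it is not the case that almost all paths have finite variation
on compact time intervals. (For Lévy processes, by a zero-one law, almost all paths then have
infinite variation.) -/
def UnboundedVariation (X : ℝ≥0 → Ω → ℝ) (P : Measure Ω) : Prop :=
  ¬ ∀ᵐ ω ∂P, LocallyBoundedVariationOn (fun t => X t ω) univ

/-- The Laplace exponent `φ(λ) = log 𝔼 e^{-λ X_1}`, so that `𝔼 e^{-λ X_t} = e^{t φ(λ)}`, `λ ≥ 0`. -/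
def laplaceExponent (X : ℝ≥0 → Ω → ℝ) (P : Measure Ω) (l : ℝ) : ℝ :=
  cgf (X 1) P (-l)

/-- The largest root of `φ` on `[0, ∞)`. -/
def theta0 (φ : ℝ → ℝ) : ℝ := sSup {s | 0 ≤ s ∧ φ s = 0}

/-- `θ₁ = inf {s > 0 : φ'(s) > 0}`. -/
def theta1 (φ : ℝ → ℝ) : ℝ := sInf {s | 0 < s ∧ 0 < deriv φ s}

/-- Weak lower scaling at infinity: `f (l x) ≥ c l^τ f x` for all `l ≥ 1` and `x > x₁`. -/
def WLSC (f : ℝ → ℝ) (τ c x₁ : ℝ) : Prop :=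
  ∀ l x : ℝ, 1 ≤ l → x₁ < x → c * l ^ τ * f x ≤ f (l * x)

/-- The inverse of a function on `(0, ∞)`. It is applied to `φ` and to `φ'` at positive values `s`,
where the equation `f r = s` has exactly one solution `r > 0`. -/
def posInv (f : ℝ → ℝ) (s : ℝ) : ℝ := sSup {r | 0 < r ∧ f r = s}

/-- `p` is the continuous density of `μ` (it is unique if it exists). -/
structure IsContinuousDensity (μ : Measure ℝ) (p : ℝ → ℝ) : Prop where
  continuous : Continuous p
  nonneg : ∀ x, 0 ≤ p x
  eq_withDensity : μ = volume.withDensity (fun x => ENNReal.ofReal (p x))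

/-- `(t φ''(w))^{-1/2} exp (-t (w φ'(w) - φ(w)))`. -/
def saddleValue (φ : ℝ → ℝ) (t w : ℝ) : ℝ :=
  1 / √(t * deriv (deriv φ) w) * Real.exp (-t * (w * deriv φ w - φ w))

end SpecPos

end

/-! The density of `X t` is the inverse Fourier integral of `exp (t φ)` over the imaginary axis, and
the contour may be moved to any line `Re z = w` with `w ≥ 0`. At the saddle point, where `t φ'(w) =
-x`, the linear term of the exponent cancels, the factor `exp (-t (w φ'(w) - φ(w)))` comes out, and
what remains is close to a Gaussian integral in `u` with variance `1 / (t φ''(w))`. With `s² = t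
φ''(w)`, the relative error is of order `1 / (s w)`, so everything hinges on `s w` being large.

Three ingredients make this quantitative. First, the decay of the integrand: `Re (φ(w) - φ(w +
iu))`, called `lkEnergy`, is at least a constant times `u² φ''(w)` for `|u| ≤ w` and `w |u| φ''(w)`
for `|u| ≥ w` (`exists_lkEnergy_bounds`). This rests on the scaling of `φ''`, and also justifies
inversion and the contour shift. Second, the cubic Taylor bound `lkExp_third_order`, which compares
the integrand with a Gaussian near the saddle. Third, the position of the saddle
(`saddle_point_spec`): if `t φ(r) = 1`, convexity and monotonicity of `φ''` give `r φ'(2r) ≤ 60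
φ(r)`, so `-x r > 60` forces `w > 2r`; then `φ'(w) ≤ D w φ''(w)` (`exists_deriv_le`, where `φ'(θ₁) =
0` enters) turns a large `-x w` into a large `(s w)²`.

Two preliminaries link this to the process. The exponent `φ` is a cumulant generating function,
whereas the process is given by characteristic functions; `exp_moment_of_bounded` bridges the two by
analytic continuation. Unbounded variation serves to exclude a pure drift, that is, `φ'' = 0`
(`lkDeriv2_pos`). -/

namespace SpecPos

/-! ### Fourier inversion for probability measures -/

/-- The inverse Fourier transform, in the normalisation of characteristic functions. -/
noncomputable def invCharFun (f : ℝ → ℂ) (x : ℝ) : ℂ :=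
  (2 * Real.pi : ℂ)⁻¹ * ∫ ξ : ℝ, Complex.exp (-(Complex.I * ξ * x)) * f ξ

lemma norm_cexp_neg_I_mul (a b : ℝ) : ‖Complex.exp (-(Complex.I * a * b))‖ = 1 := by
  rw [Complex.norm_exp]; simp

lemma norm_cexp_I_mul (a b : ℝ) : ‖Complex.exp (Complex.I * a * b)‖ = 1 := by
  rw [Complex.norm_exp]; simp

lemma invCharFun_eq_fourier (f : ℝ → ℂ) (x : ℝ) :
    invCharFun f x = (2 * Real.pi : ℂ)⁻¹ * FourierTransform.fourier f (x / (2 * Real.pi)) := by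
  rw [invCharFun, Real.fourier_real_eq_integral_exp_smul]
  congr 2
  ext ξ
  rw [smul_eq_mul]
  congr 2
  have : (Real.pi : ℂ) ≠ 0 := by exact_mod_cast Real.pi_ne_zero
  push_cast
  field_simp

lemma continuous_invCharFun {f : ℝ → ℂ} (hf : Integrable f) : Continuous (invCharFun f) := by
  unfold invCharFun
  refine continuous_const.mul ?_
  refine continuous_of_dominated (bound := fun ξ => ‖f ξ‖) ?_ ?_ hf.norm ?_
  · intro x
    exact (by fun_prop : Continuous fun ξ : ℝ =>
      Complex.exp (-(Complex.I * ξ * x))).aestronglyMeasurable.mul hf.1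
  · intro x
    refine Eventually.of_forall fun ξ => ?_
    rw [norm_mul, norm_cexp_neg_I_mul, one_mul]
  · refine Eventually.of_forall fun ξ => ?_
    fun_prop

lemma norm_invCharFun_le (f : ℝ → ℂ) (x : ℝ) :
    ‖invCharFun f x‖ ≤ (2 * Real.pi)⁻¹ * ∫ ξ, ‖f ξ‖ := by
  unfold invCharFun
  rw [norm_mul]
  have : ‖(2 * Real.pi : ℂ)⁻¹‖ = (2 * Real.pi)⁻¹ := by
    rw [norm_inv]; congr 1; simp [Real.pi_pos.le]
  rw [this]
  gcongr
  refine (norm_integral_le_integral_norm _).trans (le_of_eq ?_)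
  congr 1
  ext ξ
  rw [norm_mul, norm_cexp_neg_I_mul, one_mul]

lemma integral_exp_mul_invCharFun {f : ℝ → ℂ} (hc : Continuous f) (hf : Integrable f)
    (hp : Integrable (invCharFun f)) (ξ : ℝ) :
    ∫ x : ℝ, Complex.exp (Complex.I * ξ * x) * invCharFun f x = f ξ := by
  have hpi : (2 * Real.pi) ≠ 0 := by positivity
  have hpi' : (2 * Real.pi : ℂ) ≠ 0 := by exact_mod_cast hpi
  have hF : ∀ y, FourierTransform.fourier f y = (2 * Real.pi : ℂ) * invCharFun f (y * (2 * Real.pi)) := by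
    intro y
    rw [invCharFun_eq_fourier, mul_div_cancel_right₀ _ hpi, mul_inv_cancel_left₀ hpi']
  have hFi : Integrable (FourierTransform.fourier f) := by
    rw [show FourierTransform.fourier f =
      fun y => (2 * Real.pi : ℂ) * invCharFun f (y * (2 * Real.pi)) from funext hF]
    exact ((integrable_comp_mul_right_iff _ hpi).2 hp).const_mul _
  have key := congrFun (hc.fourierInv_fourier_eq hf hFi) ξ
  rw [Real.fourierInv_eq'] at key
  rw [← key]
  have := Measure.integral_comp_mul_right
    (fun x : ℝ => Complex.exp (Complex.I * ξ * x) * invCharFun f x) (2 * Real.pi)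
  have h2 : |(2 * Real.pi)⁻¹| = (2 * Real.pi)⁻¹ := abs_of_pos (by positivity)
  rw [h2] at this
  have e : ∀ v : ℝ, Complex.exp (↑(2 * Real.pi * inner ℝ v ξ) * Complex.I) • FourierTransform.fourier f v
      = (2 * Real.pi : ℂ) * (Complex.exp (Complex.I * ξ * ((v * (2 * Real.pi) : ℝ) : ℂ)) * invCharFun f (v * (2 * Real.pi))) := by
    intro v
    rw [hF, smul_eq_mul]
    rw [show Complex.I * ξ * ((v * (2 * Real.pi) : ℝ) : ℂ) = ↑(2 * Real.pi * inner ℝ v ξ) * Complex.I by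
      simp; ring]
    ring
  simp_rw [e]
  rw [integral_const_mul, this, Complex.real_smul]
  push_cast
  rw [mul_inv_cancel_left₀ hpi']

lemma invCharFun_gaussian {v : ℝ≥0} (hv : v ≠ 0) (y x : ℝ) :
    (2 * Real.pi : ℂ)⁻¹ * ∫ ξ : ℝ, Complex.exp (Complex.I * ξ * (y - x)) *
      Complex.exp (-((v : ℝ) / 2 : ℂ) * ξ ^ 2) = gaussianPDFReal y v x := by
  have hv' : (0 : ℝ) < v := by positivity
  have h := fourierIntegral_gaussian (b := ((v : ℝ) / 2 : ℂ)) (by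
    rw [show ((v : ℝ) / 2 : ℂ) = ((v / 2 : ℝ) : ℂ) by push_cast; rfl, Complex.ofReal_re]; positivity)
    ((y : ℂ) - x)
  have e : (fun ξ : ℝ => Complex.exp (Complex.I * ξ * (y - x)) *
      Complex.exp (-((v : ℝ) / 2 : ℂ) * ξ ^ 2)) = fun ξ : ℝ => Complex.exp (Complex.I * (y - x) * ξ) *
      Complex.exp (-((v : ℝ) / 2 : ℂ) * ξ ^ 2) := by
    ext ξ; congr 2; ring
  rw [e, h, gaussianPDFReal]
  have h1 : ((Real.pi : ℂ) / ((v : ℝ) / 2)) ^ (1 / 2 : ℂ) = ((√(2 * Real.pi / v) : ℝ) : ℂ) := by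
    rw [Real.sqrt_eq_rpow, Complex.ofReal_cpow (by positivity)]
    push_cast
    congr 1
    field_simp
  rw [h1]
  have h2 : (√(2 * Real.pi * v))⁻¹ = (2 * Real.pi)⁻¹ * √(2 * Real.pi / v) := by
    rw [Real.sqrt_mul (by positivity), Real.sqrt_div (by positivity)]
    have h3 : √(2 * Real.pi) * √(2 * Real.pi) = 2 * Real.pi := Real.mul_self_sqrt (by positivity)
    have : √(2 * Real.pi) ≠ 0 := by positivity
    have : √(v : ℝ) ≠ 0 := by positivity
    field_simp
    nlinarith
  rw [h2]
  push_cast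
  rw [mul_assoc]
  congr 3
  field_simp
  ring

lemma integrable_gaussian_factor {v : ℝ≥0} (hv : v ≠ 0) :
    Integrable (fun ξ : ℝ => Complex.exp (-((v : ℝ) / 2 : ℂ) * ξ ^ 2)) := by
  apply integrable_cexp_neg_mul_sq
  rw [show ((v : ℝ) / 2 : ℂ) = ((v / 2 : ℝ) : ℂ) by push_cast; rfl, Complex.ofReal_re]
  have : (0 : ℝ) < v := by positivity
  positivity

/-- Gaussian damping of the characteristic function is convolution with a Gaussian law. The damping
makes Fubini available, and the resulting value is visibly real and nonnegative, which inversion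
alone does not show. -/
lemma invCharFun_charFun_mul_gaussian (μ : Measure ℝ) [IsProbabilityMeasure μ] {v : ℝ≥0}
    (hv : v ≠ 0) (x : ℝ) :
    invCharFun (fun ξ => charFun μ ξ * Complex.exp (-((v : ℝ) / 2 : ℂ) * ξ ^ 2)) x =
      ((∫ y, gaussianPDFReal y v x ∂μ : ℝ) : ℂ) := by
  rw [invCharFun]
  simp_rw [charFun_apply_real]
  have e : ∀ ξ : ℝ, Complex.exp (-(Complex.I * ξ * x)) * ((∫ y : ℝ, Complex.exp (ξ * y * Complex.I) ∂μ) *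
      Complex.exp (-((v : ℝ) / 2 : ℂ) * ξ ^ 2)) = ∫ y : ℝ, Complex.exp (Complex.I * ξ * (y - x)) *
      Complex.exp (-((v : ℝ) / 2 : ℂ) * ξ ^ 2) ∂μ := by
    intro ξ
    rw [integral_mul_const, ← mul_assoc, ← integral_const_mul]
    congr 2
    ext y
    rw [← Complex.exp_add]
    congr 1
    ring
  simp_rw [e]
  rw [integral_integral_swap, ← integral_const_mul]
  · simp_rw [invCharFun_gaussian hv]
    exact integral_ofReal
  · have h1 : Integrable (fun z : ℝ × ℝ => Complex.exp (-((v : ℝ) / 2 : ℂ) * z.1 ^ 2))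
        (volume.prod μ) := (integrable_gaussian_factor hv).comp_fst μ
    refine h1.mono ?_ ?_
    · refine Continuous.aestronglyMeasurable ?_
      simp only [Function.uncurry_def]
      fun_prop
    · refine Eventually.of_forall fun z => ?_
      simp only [Function.uncurry_def, norm_mul]
      have h2 : ‖Complex.exp (Complex.I * z.1 * (z.2 - x))‖ = 1 := by
        rw [← norm_cexp_I_mul z.1 (z.2 - x)]; push_cast; rfl
      rw [h2, one_mul]

lemma tendsto_invCharFun_mul_gaussian {f : ℝ → ℂ} (hf : Integrable f) (x : ℝ) :
    Tendsto (fun n : ℕ => invCharFun (fun ξ => f ξ *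
      Complex.exp (-((((n : ℝ≥0) + 1)⁻¹ : ℝ≥0) : ℝ) / 2 * ξ ^ 2)) x) atTop
      (𝓝 (invCharFun f x)) := by
  unfold invCharFun
  refine Tendsto.const_mul _ ?_
  have hb : ∀ (r : ℝ≥0) (ξ : ℝ), ‖Complex.exp (-(r : ℝ) / 2 * ξ ^ 2)‖ ≤ 1 := by
    intro r ξ
    rw [show (-(r : ℝ) / 2 * ξ ^ 2 : ℂ) = ((-(r : ℝ) / 2 * ξ ^ 2 : ℝ) : ℂ) by push_cast; ring,
      Complex.norm_exp, Complex.ofReal_re, Real.exp_le_one_iff]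
    have : 0 ≤ (r : ℝ) / 2 * ξ ^ 2 := by positivity
    linarith
  refine tendsto_integral_of_dominated_convergence (fun ξ => ‖f ξ‖) ?_ hf.norm ?_ ?_
  · intro n
    refine (by fun_prop : Continuous fun ξ : ℝ =>
      Complex.exp (-(Complex.I * ξ * x))).aestronglyMeasurable.mul (hf.1.mul ?_)
    refine Continuous.aestronglyMeasurable ?_
    fun_prop
  · intro n
    refine Eventually.of_forall fun ξ => ?_
    rw [norm_mul, norm_cexp_neg_I_mul, one_mul, norm_mul]
    exact mul_le_of_le_one_right (norm_nonneg _) (hb _ _)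
  · refine Eventually.of_forall fun ξ => ?_
    refine Tendsto.const_mul _ ?_
    rw [← mul_one (f ξ)]
    refine Tendsto.mul (by simp) ?_
    have h0 : Tendsto (fun n : ℕ => ((n : ℝ) + 1)⁻¹) atTop (𝓝 0) := by
      simpa using tendsto_one_div_add_atTop_nhds_zero_nat (𝕜 := ℝ)
    have h1 : Continuous fun r : ℝ => Complex.exp (-(r : ℂ) / 2 * ξ ^ 2) := by fun_prop
    have h2 := (h1.tendsto 0).comp h0
    simp only [Function.comp_def] at h2
    simpa using h2

/-- A probability measure with integrable characteristic function has a continuous density, given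
by Fourier inversion. -/
theorem isContinuousDensity_of_integrable_charFun (μ : Measure ℝ) [IsProbabilityMeasure μ]
    (h : Integrable (charFun μ)) :
    IsContinuousDensity μ (fun x => (invCharFun (charFun μ) x).re) ∧
      (∀ x, ((invCharFun (charFun μ) x).re : ℂ) = invCharFun (charFun μ) x) ∧
      Integrable (invCharFun (charFun μ)) := by
  set q := invCharFun (charFun μ) with hq
  set v : ℕ → ℝ≥0 := fun n => ((n : ℝ≥0) + 1)⁻¹ with hv
  have hv0 : ∀ n, v n ≠ 0 := fun n => by simp only [hv]; positivity
  set g : ℕ → ℝ → ℝ := fun n x => ∫ y, gaussianPDFReal y (v n) x ∂μ with hg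
  have hlim : ∀ x, Tendsto (fun n => ((g n x : ℝ) : ℂ)) atTop (𝓝 (q x)) := by
    intro x
    have := tendsto_invCharFun_mul_gaussian h x
    refine this.congr fun n => ?_
    rw [← invCharFun_charFun_mul_gaussian μ (hv0 n) x]
    simp only [hv, neg_div]
  have hre : ∀ x, Tendsto (fun n => g n x) atTop (𝓝 (q x).re) := fun x =>
    (Complex.continuous_re.tendsto _).comp (hlim x)
  have him : ∀ x, (q x).im = 0 := by
    intro x
    have := (Complex.continuous_im.tendsto _).comp (hlim x)
    simp only [Function.comp_def, Complex.ofReal_im] at this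
    exact tendsto_nhds_unique this tendsto_const_nhds
  have hreal : ∀ x, ((q x).re : ℂ) = q x := fun x => by
    apply Complex.ext <;> simp [him]
  have hnn : ∀ x, 0 ≤ (q x).re := fun x =>
    ge_of_tendsto' (hre x) fun n => integral_nonneg fun y => gaussianPDFReal_nonneg _ _ _
  have hcont : Continuous q := continuous_invCharFun h
  have hcr : Continuous fun x => (q x).re := Complex.continuous_re.comp hcont
  have hswap : ∀ n, ∀ y x, gaussianPDFReal y (v n) x = gaussianPDFReal x (v n) y := by
    intro n y x
    simp only [gaussianPDFReal]
    rw [show (x - y) ^ 2 = (y - x) ^ 2 by ring]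
  have hgm2 : ∀ n, Measurable fun z : ℝ × ℝ => gaussianPDFReal z.1 (v n) z.2 := by
    intro n
    unfold gaussianPDFReal
    fun_prop
  have hgl : ∀ n x, ENNReal.ofReal (g n x) = ∫⁻ y, ENNReal.ofReal (gaussianPDFReal y (v n) x) ∂μ := by
    intro n x
    simp only [hg]
    refine ofReal_integral_eq_lintegral_ofReal ?_ (Eventually.of_forall fun y => gaussianPDFReal_nonneg _ _ _)
    refine Integrable.of_bound (C := (√(2 * Real.pi * v n))⁻¹) ?_ (Eventually.of_forall fun y => ?_)
    · exact ((hgm2 n).comp (measurable_id.prodMk measurable_const)).aestronglyMeasurable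
    · rw [Real.norm_of_nonneg (gaussianPDFReal_nonneg _ _ _), gaussianPDFReal]
      refine mul_le_of_le_one_right (by positivity) ?_
      rw [Real.exp_le_one_iff]
      have : 0 ≤ (x - y) ^ 2 / (2 * (v n : ℝ)) := by positivity
      rw [neg_div]; linarith
  have hgi : ∀ n, ∫⁻ x, ENNReal.ofReal (g n x) = 1 := by
    intro n
    simp_rw [hgl]
    rw [lintegral_lintegral_swap]
    · simp_rw [lintegral_gaussianPDFReal_eq_one _ (hv0 n)]
      simp
    · exact (((hgm2 n).comp measurable_swap).ennreal_ofReal).aemeasurable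
  -- Fatou: the smoothed densities `g n` have total mass one and converge pointwise to `q`.
  -- Integrability of `q` is what inversion needs in order to recover the characteristic function.
  have hlint : ∫⁻ x, ENNReal.ofReal (q x).re ≤ 1 := by
    calc ∫⁻ x, ENNReal.ofReal (q x).re
        = ∫⁻ x, liminf (fun n => ENNReal.ofReal (g n x)) atTop := by
          congr 1; ext x
          exact (((ENNReal.continuous_ofReal.tendsto _).comp (hre x)).liminf_eq).symm
      _ ≤ liminf (fun n => ∫⁻ x, ENNReal.ofReal (g n x)) atTop := by
          refine lintegral_liminf_le fun n => ?_
          simp_rw [hgl]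
          exact Measurable.lintegral_prod_left' (f := fun z : ℝ × ℝ =>
            ENNReal.ofReal (gaussianPDFReal z.1 (v n) z.2)) (hgm2 n).ennreal_ofReal
      _ = 1 := by simp_rw [hgi]; simp
  have hint_re : Integrable fun x => (q x).re := by
    refine ⟨hcr.aestronglyMeasurable, ?_⟩
    rw [hasFiniteIntegral_iff_ofReal (Eventually.of_forall hnn)]
    exact hlint.trans_lt ENNReal.one_lt_top
  have hint : Integrable q := by
    have := hint_re.ofReal (𝕜 := ℂ)
    refine this.congr (Eventually.of_forall fun x => hreal x)
  refine ⟨⟨hcr, hnn, ?_⟩, hreal, hint⟩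
  have hfin : IsFiniteMeasure (volume.withDensity fun x => ENNReal.ofReal (q x).re) :=
    isFiniteMeasure_withDensity_ofReal hint_re.2
  refine Measure.ext_of_charFun ?_
  ext ξ
  rw [← integral_exp_mul_invCharFun continuous_charFun h hint ξ, charFun_apply_real,
    integral_withDensity_eq_integral_toReal_smul₀ (by fun_prop) (by simp)]
  congr 1
  ext x
  rw [ENNReal.toReal_ofReal (hnn x), Complex.real_smul, hreal x, mul_comm]
  congr 2
  ring

/-! ### Shifting the contour in the right half-plane -/

lemma integrable_exp_neg_mul_abs {a : ℝ} (ha : 0 < a) :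
    Integrable (fun u : ℝ => Real.exp (-a * |u|)) := by
  have h1 : IntegrableOn (fun u : ℝ => Real.exp (-a * |u|)) (Ioi 0) := by
    refine (integrableOn_exp_mul_Ioi (a := -a) (by linarith) 0).congr_fun ?_ measurableSet_Ioi
    intro u hu
    simp only [abs_of_pos (mem_Ioi.1 hu)]
  have h2 : IntegrableOn (fun u : ℝ => Real.exp (-a * |u|)) (Iic 0) := by
    refine (integrableOn_exp_mul_Iic ha 0).congr_fun ?_ measurableSet_Iic
    intro u hu
    simp only [abs_of_nonpos (mem_Iic.1 hu)]
    congr 1; ring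
  rw [← integrableOn_univ, ← Iic_union_Ioi (a := (0 : ℝ))]
  exact h2.union h1

/-- `F` is continuous on the closed right half-plane and holomorphic in the open one. -/
structure HalfPlaneHolo (F : ℂ → ℂ) : Prop where
  continuousOn : ContinuousOn F {z | 0 ≤ z.re}
  differentiableAt : ∀ z : ℂ, 0 < z.re → DifferentiableAt ℂ F z

/-- `F` decays exponentially along vertical lines, uniformly on vertical strips. -/
def StripDecay (F : ℂ → ℂ) : Prop :=
  ∀ w : ℝ, 0 ≤ w → ∃ B a : ℝ, 0 < a ∧ ∀ l ∈ Icc 0 w, ∀ u : ℝ,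
    ‖F (l + u * Complex.I)‖ ≤ B * Real.exp (-a * |u|)

lemma HalfPlaneHolo.continuous_vertical {F : ℂ → ℂ} (hF : HalfPlaneHolo F) {w : ℝ} (hw : 0 ≤ w) :
    Continuous fun u : ℝ => F (w + u * Complex.I) := by
  refine hF.continuousOn.comp_continuous (by fun_prop) fun u => ?_
  simpa using hw

lemma StripDecay.integrable_vertical {F : ℂ → ℂ} (hF : HalfPlaneHolo F) (hd : StripDecay F)
    {w : ℝ} (hw : 0 ≤ w) : Integrable fun u : ℝ => F (w + u * Complex.I) := by
  obtain ⟨B, a, ha, hB⟩ := hd w hw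
  refine ((integrable_exp_neg_mul_abs ha).const_mul B).mono'
    (hF.continuous_vertical hw).aestronglyMeasurable (Eventually.of_forall fun u => hB w ⟨hw, le_rfl⟩ u)

/-- Cauchy's theorem on the rectangle `[0, w] × [-R, R]`; strip decay makes the horizontal sides
vanish as `R → ∞`. -/
lemma integral_vertical_eq {F : ℂ → ℂ} (hF : HalfPlaneHolo F) (hd : StripDecay F) {w : ℝ}
    (hw : 0 ≤ w) : ∫ u : ℝ, F (u * Complex.I) = ∫ u : ℝ, F (w + u * Complex.I) := by
  obtain ⟨B, a, ha, hB⟩ := hd w hw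
  have hrect : ∀ R : ℝ, (∫ y in (-R)..R, F (w + y * Complex.I)) - ∫ y in (-R)..R, F (y * Complex.I) =
      Complex.I * ((∫ x in (0 : ℝ)..w, F (x + (-R : ℝ) * Complex.I)) -
        ∫ x in (0 : ℝ)..w, F (x + R * Complex.I)) := by
    intro R
    have h := Complex.integral_boundary_rect_eq_zero_of_continuousOn_of_differentiableOn F
      (⟨0, -R⟩ : ℂ) (⟨w, R⟩ : ℂ) ?_ ?_
    · simp only [smul_eq_mul, Complex.ofReal_zero, zero_add] at h
      have hI : Complex.I * Complex.I = -1 := Complex.I_mul_I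
      linear_combination (-Complex.I) * h + ((∫ y in (-R)..R, F (w + y * Complex.I)) - ∫ y in (-R)..R, F (y * Complex.I)) * hI
    · refine hF.continuousOn.mono fun z hz => ?_
      rw [Complex.mem_reProdIm] at hz
      have := hz.1
      simp only [uIcc_of_le hw] at this
      exact this.1
    · intro z hz
      rw [Complex.mem_reProdIm] at hz
      have := hz.1
      simp only [min_eq_left hw] at this
      exact (hF.differentiableAt z this.1).differentiableWithinAt
  have hbd : ∀ R : ℝ, ‖∫ x in (0 : ℝ)..w, F (x + R * Complex.I)‖ ≤ B * Real.exp (-a * |R|) * |w - 0| := by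
    intro R
    refine intervalIntegral.norm_integral_le_of_norm_le_const fun x hx => ?_
    rw [uIoc_of_le hw] at hx
    exact hB x ⟨hx.1.le, hx.2⟩ R
  have hexp : Tendsto (fun R : ℝ => B * Real.exp (-a * |R|) * |w - 0|) atTop (𝓝 0) := by
    have h1 : Tendsto (fun R : ℝ => Real.exp (-a * |R|)) atTop (𝓝 0) := by
      refine Real.tendsto_exp_atBot.comp ?_
      exact (tendsto_abs_atTop_atTop).const_mul_atTop_of_neg (by linarith)
    simpa using (h1.const_mul B).mul_const |w - 0|
  have hz1 : Tendsto (fun R : ℝ => ∫ x in (0 : ℝ)..w, F (x + R * Complex.I)) atTop (𝓝 0) :=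
    squeeze_zero_norm hbd hexp
  have hz2 : Tendsto (fun R : ℝ => ∫ x in (0 : ℝ)..w, F (x + (-R : ℝ) * Complex.I)) atTop (𝓝 0) := by
    refine squeeze_zero_norm (fun R => ?_) hexp
    simpa using hbd (-R)
  have hi0 := StripDecay.integrable_vertical hF hd le_rfl
  simp only [Complex.ofReal_zero, zero_add] at hi0
  have hl := (intervalIntegral_tendsto_integral (StripDecay.integrable_vertical hF hd hw)
    tendsto_neg_atTop_atBot tendsto_id).sub
      (intervalIntegral_tendsto_integral hi0 tendsto_neg_atTop_atBot tendsto_id)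
  have hr : Tendsto (fun R : ℝ => Complex.I * ((∫ x in (0 : ℝ)..w, F (x + (-R : ℝ) * Complex.I)) -
        ∫ x in (0 : ℝ)..w, F (x + R * Complex.I))) atTop (𝓝 0) := by
    simpa using (hz2.sub hz1).const_mul Complex.I
  have := tendsto_nhds_unique hl (hr.congr fun R => (hrect R).symm)
  exact (sub_eq_zero.1 this).symm

lemma HalfPlaneHolo.exp_mul {F : ℂ → ℂ} (hF : HalfPlaneHolo F) (x : ℝ) :
    HalfPlaneHolo fun z => Complex.exp (z * x) * F z :=
  ⟨(by fun_prop : Continuous fun z : ℂ => Complex.exp (z * x)).continuousOn.mul hF.continuousOn,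
    fun z hz => (by fun_prop : DifferentiableAt ℂ (fun z : ℂ => Complex.exp (z * x)) z).mul
      (hF.differentiableAt z hz)⟩

lemma StripDecay.exp_mul {F : ℂ → ℂ} (hF : StripDecay F) (x : ℝ) :
    StripDecay fun z => Complex.exp (z * x) * F z := by
  intro w hw
  obtain ⟨B, a, ha, hB⟩ := hF w hw
  refine ⟨Real.exp (w * |x|) * B, a, ha, fun l hl u => ?_⟩
  rw [norm_mul, Complex.norm_exp, mul_assoc]
  refine mul_le_mul ?_ (hB l hl u) (norm_nonneg _) (Real.exp_pos _).le
  rw [Real.exp_le_exp]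
  simp only [Complex.mul_re, Complex.add_re, Complex.ofReal_re, Complex.I_re, mul_zero,
    Complex.ofReal_im, Complex.I_im, mul_one, sub_self, add_zero, sub_zero]
  calc l * x ≤ l * |x| := mul_le_mul_of_nonneg_left (le_abs_self x) hl.1
    _ ≤ w * |x| := mul_le_mul_of_nonneg_right hl.2 (abs_nonneg x)

/-- Moving the line of integration in the inversion formula. -/
lemma invCharFun_shift {F : ℂ → ℂ} (hF : HalfPlaneHolo F) (hd : StripDecay F) {w : ℝ}
    (hw : 0 ≤ w) (x : ℝ) :
    invCharFun (fun ξ : ℝ => F (-(ξ * Complex.I))) x =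
      Complex.exp (w * x) * invCharFun (fun ξ : ℝ => F (w - ξ * Complex.I)) x := by
  have h := integral_vertical_eq (hF.exp_mul x) (hd.exp_mul x) hw
  rw [← integral_neg_eq_self, ← integral_neg_eq_self (fun u : ℝ => Complex.exp ((w + u * Complex.I) * x) * F (w + u * Complex.I))] at h
  have e1 : ∀ ξ : ℝ, Complex.exp (-(Complex.I * ξ * x)) * F (-(ξ * Complex.I)) =
      Complex.exp ((-ξ : ℝ) * Complex.I * x) * F ((-ξ : ℝ) * Complex.I) := by
    intro ξ
    push_cast
    congr 2 <;> ring
  have e2 : ∀ ξ : ℝ, Complex.exp (w * x) * (Complex.exp (-(Complex.I * ξ * x)) *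
      F (w - ξ * Complex.I)) =
      Complex.exp ((w + (-ξ : ℝ) * Complex.I) * x) * F (w + (-ξ : ℝ) * Complex.I) := by
    intro ξ
    rw [← mul_assoc, ← Complex.exp_add]
    push_cast
    rw [neg_mul, ← sub_eq_add_neg]
    congr 2
    ring
  unfold invCharFun
  rw [mul_left_comm, ← integral_const_mul (Complex.exp (w * x))]
  simp_rw [e1, e2]
  rw [h]

/-! ### Exponential moments from the continued characteristic function -/

/-- By the contour shift, the density tilted by `exp (-w x)` is itself the inverse transform of `F`
on the line `Re z = w`. -/
lemma exp_moment_of_stripDecay (μ : Measure ℝ) [IsProbabilityMeasure μ] {F : ℂ → ℂ}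
    (hF : HalfPlaneHolo F) (hd : StripDecay F)
    (hμ : ∀ ξ : ℝ, charFun μ ξ = F (-(ξ * Complex.I))) {w : ℝ} (hw : 0 ≤ w) :
    Integrable (fun x => Real.exp (-w * x)) μ ∧ ∫ x, (Real.exp (-w * x) : ℂ) ∂μ = F w := by
  have hvert : ∀ w : ℝ, 0 ≤ w → Integrable fun ξ : ℝ => F (w - ξ * Complex.I) := by
    intro w hw
    have := (StripDecay.integrable_vertical hF hd hw).comp_neg
    refine this.congr (Eventually.of_forall fun u => ?_)
    simp only; congr 1; push_cast; ring
  have hcf : charFun μ = fun ξ : ℝ => F (-(ξ * Complex.I)) := funext hμ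
  have hint : Integrable (charFun μ) := by
    rw [hcf]
    simpa using hvert 0 le_rfl
  obtain ⟨hdens, hreal, hqi⟩ := isContinuousDensity_of_integrable_charFun μ hint
  set q := invCharFun (charFun μ) with hq
  set p : ℝ → ℝ := fun x => (q x).re with hp
  have hshift : ∀ w : ℝ, 0 ≤ w → ∀ x : ℝ, Complex.exp (-w * x) * q x =
      invCharFun (fun ξ : ℝ => F (w - ξ * Complex.I)) x := by
    intro w hw x
    rw [hq, hcf, invCharFun_shift hF hd hw x, ← mul_assoc, ← Complex.exp_add]
    simp
  have hqc : Continuous q := continuous_invCharFun hint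
  have hqint : Integrable (fun x : ℝ => Complex.exp (-w * x) * q x) := by
    -- Shifting one unit beyond `w` gains the factor `exp x`, integrable at `-∞`; at `+∞` the tilted
    -- density is dominated by `q`.
    set D := (2 * Real.pi)⁻¹ * ∫ ξ : ℝ, ‖F ((w + 1 : ℝ) - ξ * Complex.I)‖ with hD
    have hDb : ∀ x : ℝ, ‖Complex.exp (-(w + 1 : ℝ) * x) * q x‖ ≤ D := by
      intro x
      rw [hshift _ (by linarith)]
      exact norm_invCharFun_le _ _
    have hD0 : 0 ≤ D := (norm_nonneg _).trans (hDb 0)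
    refine (hqi.norm.add ((integrable_exp_neg_mul_abs one_pos).const_mul D)).mono' ?_ ?_
    · exact (Continuous.mul (by fun_prop) hqc).aestronglyMeasurable
    · refine Eventually.of_forall fun x => ?_
      simp only [Pi.add_apply]
      rcases le_total 0 x with hx | hx
      · have : ‖Complex.exp (-w * x)‖ ≤ 1 := by
          rw [Complex.norm_exp, show (-(w : ℂ) * x) = ((-w * x : ℝ) : ℂ) by push_cast; rfl,
            Complex.ofReal_re, Real.exp_le_one_iff]
          nlinarith
        rw [norm_mul]
        calc _ ≤ 1 * ‖q x‖ := by gcongr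
          _ ≤ _ := by rw [one_mul]; exact le_add_of_nonneg_right (by positivity)
      · have e : Complex.exp (-w * x) * q x = Complex.exp x * (Complex.exp (-(w + 1 : ℝ) * x) * q x) := by
          rw [← mul_assoc, ← Complex.exp_add]; congr 2; push_cast; ring
        rw [e, norm_mul, Complex.norm_exp, Complex.ofReal_re, abs_of_nonpos hx]
        calc _ ≤ Real.exp x * D := by gcongr; exact hDb x
          _ = D * Real.exp (-1 * -x) := by rw [mul_comm]; congr 2; ring
          _ ≤ _ := le_add_of_nonneg_left (norm_nonneg _)
  have hpm : Measurable fun x => ENNReal.ofReal (p x) := hdens.continuous.measurable.ennreal_ofReal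
  have hpe : (fun x : ℝ => (ENNReal.ofReal (p x)).toReal • (Real.exp (-w * x) : ℂ)) =
      fun x : ℝ => Complex.exp (-w * x) * q x := by
    ext x
    rw [ENNReal.toReal_ofReal (hdens.nonneg x), Complex.real_smul, hreal x, mul_comm]
    push_cast; rfl
  have hI : Integrable (fun x : ℝ => (Real.exp (-w * x) : ℂ)) μ := by
    rw [hdens.eq_withDensity, integrable_withDensity_iff_integrable_smul' hpm (by simp), hpe]
    exact hqint
  refine ⟨by simpa [-Complex.ofReal_exp] using hI.re, ?_⟩
  rw [hdens.eq_withDensity, integral_withDensity_eq_integral_toReal_smul₀ hpm.aemeasurable (by simp),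
    hpe]
  simp_rw [hshift w hw]
  -- The moment is the Fourier transform of the tilted density at frequency `0`.
  have hinv := integral_exp_mul_invCharFun (f := fun ξ : ℝ => F (w - ξ * Complex.I)) ?_ (hvert w hw) ?_ 0
  · simpa using hinv
  · refine hF.continuousOn.comp_continuous (by fun_prop) fun u => ?_
    simpa using hw
  · refine hqint.congr (Eventually.of_forall fun x => hshift w hw x)

/-- If the characteristic function of `μ` has a bounded holomorphic extension to vertical strips of
the right half-plane, then `μ` has exponential moments on that side, given by the extension. -/
theorem exp_moment_of_bounded (μ : Measure ℝ) [IsProbabilityMeasure μ] {F : ℂ → ℂ}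
    (hF : HalfPlaneHolo F)
    (hb : ∀ w : ℝ, 0 ≤ w → ∃ B : ℝ, ∀ l ∈ Icc 0 w, ∀ u : ℝ, ‖F (l + u * Complex.I)‖ ≤ B)
    (hμ : ∀ ξ : ℝ, charFun μ ξ = F (-(ξ * Complex.I))) {w : ℝ} (hw : 0 ≤ w) :
    Integrable (fun x => Real.exp (-w * x)) μ ∧ ∫ x, (Real.exp (-w * x) : ℂ) ∂μ = F w := by
  -- On strips `exp (z ^ 2)` turns boundedness into exponential decay. At `z = -iξ` it equals `exp
  -- (-ξ²)`, the characteristic function of a centred Gaussian of variance `2`, so `G` belongs to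
  -- the convolution of `μ` with that law.
  set G : ℂ → ℂ := fun z => F z * Complex.exp (z ^ 2) with hG
  have hGF : HalfPlaneHolo G :=
    ⟨hF.continuousOn.mul (by fun_prop), fun z hz => (hF.differentiableAt z hz).mul (by fun_prop)⟩
  have hGd : StripDecay G := by
    intro w hw
    obtain ⟨B, hB⟩ := hb w hw
    have hB0 : 0 ≤ B := (norm_nonneg _).trans (hB 0 ⟨le_rfl, hw⟩ 0)
    refine ⟨B * Real.exp (w ^ 2 + 1), 1, one_pos, fun l hl u => ?_⟩
    rw [hG]
    simp only [norm_mul]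
    rw [mul_assoc, ← Real.exp_add]
    refine mul_le_mul (hB l hl u) ?_ (norm_nonneg _) hB0
    rw [Complex.norm_exp, Real.exp_le_exp]
    have : (((l : ℂ) + u * Complex.I) ^ 2).re = l ^ 2 - u ^ 2 := by
      simp [pow_two]
    rw [this, ← sq_abs u]
    have h1 : l ^ 2 ≤ w ^ 2 := pow_le_pow_left₀ hl.1 hl.2 2
    nlinarith [sq_nonneg (|u| - 1), abs_nonneg u]
  set γ := gaussianReal 0 2 with hγ
  have hconv : ∀ ξ : ℝ, charFun (μ ∗ γ) ξ = G (-(ξ * Complex.I)) := by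
    intro ξ
    rw [charFun_conv, hμ, hγ, charFun_gaussianReal, hG]
    simp only
    congr 2
    rw [neg_sq, mul_pow, Complex.I_sq]
    push_cast
    ring
  have : IsProbabilityMeasure (μ ∗ γ) := inferInstance
  obtain ⟨hi, he⟩ := exp_moment_of_stripDecay (μ ∗ γ) hGF hGd hconv hw
  have hi2 : Integrable (fun z : ℝ × ℝ => Real.exp (-w * z.1) * Real.exp (-w * z.2)) (μ.prod γ) := by
    have := (integrable_map_measure (μ := μ.prod γ) (f := fun z : ℝ × ℝ => z.1 + z.2)
      (g := fun x => Real.exp (-w * x)) (by fun_prop) (by fun_prop)).1 hi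
    refine this.congr (Eventually.of_forall fun z => ?_)
    simp only [Function.comp]
    rw [← Real.exp_add]; congr 1; ring
  have hμi : Integrable (fun x => Real.exp (-w * x)) μ := by
    -- One integrable section suffices: for fixed `y` the second factor is a nonzero constant.
    obtain ⟨y, hy⟩ := hi2.prod_left_ae.exists
    exact (integrable_mul_const_iff (IsUnit.mk0 _ (Real.exp_pos (-w * y)).ne') _).1 hy
  refine ⟨hμi, ?_⟩
  have hg : ∫ y, Real.exp (-w * y) ∂γ = Real.exp (w ^ 2) := by
    have h := mgf_gaussianReal (p := γ) (μ := 0) (v := 2) (X := id) (by simp [hγ]) (-w)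
    rw [mgf] at h
    simp only [id] at h
    rw [h]
    congr 1
    push_cast
    ring
  have hpr : ∫ x, (Real.exp (-w * x) : ℂ) ∂(μ ∗ γ) =
      (∫ x, (Real.exp (-w * x) : ℂ) ∂μ) * (Real.exp (w ^ 2) : ℂ) := by
    have h1 : ∫ x, (Real.exp (-w * x) : ℂ) ∂(μ ∗ γ) =
        ∫ z : ℝ × ℝ, (Real.exp (-w * (z.1 + z.2)) : ℂ) ∂(μ.prod γ) :=
      integral_map (μ := μ.prod γ) (φ := fun z : ℝ × ℝ => z.1 + z.2)
      (f := fun x => (Real.exp (-w * x) : ℂ)) (by fun_prop) (by fun_prop)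
    rw [h1, ← hg, ← integral_complex_ofReal, ← integral_prod_mul]
    congr 1
    ext z
    rw [← Complex.ofReal_mul, ← Real.exp_add]; congr 2; ring
  rw [hpr, hG] at he
  simp only at he
  have h0 : Complex.exp ((w : ℂ) ^ 2) ≠ 0 := Complex.exp_ne_zero _
  refine mul_right_cancel₀ h0 ?_
  rw [← he]
  push_cast
  rfl

/-! ### The Lévy-Khintchine integrals and their derivatives -/

/-- The truncation `x 1_{x < 1}`. -/
noncomputable def trunc (x : ℝ) : ℝ := if x < 1 then x else 0

lemma measurable_trunc : Measurable trunc :=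
  Measurable.ite measurableSet_Iio measurable_id measurable_const

lemma norm_exp_neg_le_one {y : ℂ} (hy : 0 ≤ y.re) : ‖Complex.exp (-y)‖ ≤ 1 := by
  rw [Complex.norm_exp, Real.exp_le_one_iff]; simpa using hy

lemma norm_exp_neg_sub_one_le {y : ℂ} (hy : 0 ≤ y.re) : ‖Complex.exp (-y) - 1‖ ≤ 2 * ‖y‖ := by
  rcases le_total ‖y‖ 1 with h | h
  · have := Complex.norm_exp_sub_one_le (x := -y) (by simpa using h)
    simpa using this
  · calc ‖Complex.exp (-y) - 1‖ ≤ ‖Complex.exp (-y)‖ + ‖(1 : ℂ)‖ := norm_sub_le _ _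
      _ ≤ 1 + 1 := by gcongr; exacts [norm_exp_neg_le_one hy, by simp]
      _ ≤ 2 * ‖y‖ := by linarith

lemma norm_exp_neg_sub_one_add_le {y : ℂ} (hy : 0 ≤ y.re) :
    ‖Complex.exp (-y) - 1 + y‖ ≤ 3 * ‖y‖ ^ 2 := by
  rcases le_total ‖y‖ 1 with h | h
  · have := Complex.norm_exp_sub_one_sub_id_le (x := -y) (by simpa using h)
    rw [sub_neg_eq_add, norm_neg] at this
    nlinarith [sq_nonneg ‖y‖]
  · calc ‖Complex.exp (-y) - 1 + y‖ ≤ ‖Complex.exp (-y) - 1‖ + ‖y‖ := norm_add_le _ _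
      _ ≤ 2 * ‖y‖ + ‖y‖ := by gcongr; exact norm_exp_neg_sub_one_le hy
      _ ≤ 3 * ‖y‖ ^ 2 := by nlinarith

lemma norm_cexp_third_order (y : ℝ) :
    ‖Complex.exp (-(Complex.I * y)) - 1 + Complex.I * y + (y : ℂ) ^ 2 / 2‖ ≤ 4 * |y| ^ 3 := by
  have hn : ‖-(Complex.I * y)‖ = |y| := by simp
  rcases le_total |y| 1 with h | h
  · have := Complex.exp_bound (x := -(Complex.I * y)) (by rw [hn]; exact h) (n := 3) (by norm_num)
    rw [hn] at this
    have e : Complex.exp (-(Complex.I * y)) - ∑ m ∈ Finset.range 3, (-(Complex.I * y)) ^ m / (m.factorial : ℂ)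
        = Complex.exp (-(Complex.I * y)) - 1 + Complex.I * y + (y : ℂ) ^ 2 / 2 := by
      simp only [Finset.sum_range_succ, Finset.sum_range_zero, Nat.factorial]
      push_cast
      rw [neg_sq, mul_pow, Complex.I_sq]
      ring
    rw [e] at this
    refine this.trans ?_
    rw [mul_comm]
    gcongr
    norm_num [Nat.factorial]
  · have h1 : ‖Complex.exp (-(Complex.I * y)) - 1‖ ≤ 2 * |y| := by
      have := norm_exp_neg_sub_one_le (y := Complex.I * y) (by simp)
      simpa using this
    calc _ ≤ ‖Complex.exp (-(Complex.I * y)) - 1‖ + ‖Complex.I * y‖ + ‖(y : ℂ) ^ 2 / 2‖ :=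
          norm_add₃_le
      _ ≤ 2 * |y| + |y| + |y| ^ 2 / 2 := by
          gcongr
          · simp
          · simp
      _ ≤ 4 * |y| ^ 3 := by
          nlinarith [mul_le_mul h h zero_le_one (abs_nonneg y), pow_pos (one_pos.trans_le h) 3,
            mul_nonneg (sub_nonneg.2 h) (sq_nonneg |y|), pow_two |y|]

/-- The measure lives on `(0, ∞)` and integrates `1 ∧ x²`. -/
structure IsLevyOnPos (ρ : Measure ℝ) : Prop where
  pos : ∀ᵐ x ∂ρ, 0 < x
  integrable : Integrable (fun x : ℝ => min 1 (x ^ 2)) ρ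

lemma IsPosLevyMeasure.isLevyOnPos {ν : Measure ℝ} (h : IsPosLevyMeasure ν) :
    IsLevyOnPos (ν.restrict (Ioi 0)) where
  pos := ae_restrict_mem measurableSet_Ioi
  integrable := by
    refine ⟨by fun_prop, ?_⟩
    rw [hasFiniteIntegral_iff_ofReal (Eventually.of_forall fun x => by positivity)]
    exact h.lintegral_lt_top

lemma IsLevyOnPos.integrable_of_bound {ρ : Measure ℝ} (hρ : IsLevyOnPos ρ) {E : Type*}
    [NormedAddCommGroup E] {f : ℝ → E} (hf : AEStronglyMeasurable f ρ) (C : ℝ)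
    (h : ∀ x, 0 < x → ‖f x‖ ≤ C * min 1 (x ^ 2)) : Integrable f ρ :=
  (hρ.integrable.const_mul C).mono' hf (hρ.pos.mono fun x hx => h x hx)

/-- The Lévy-Khintchine integrand. -/
noncomputable def lkKernel (z : ℂ) (x : ℝ) : ℂ := Complex.exp (-(z * x)) - 1 + z * trunc x

/-- The derivative of the Lévy-Khintchine integrand. -/
noncomputable def lkKernel' (z : ℂ) (x : ℝ) : ℂ := -(x * Complex.exp (-(z * x))) + trunc x

lemma norm_lkKernel_le {z : ℂ} (hz : 0 ≤ z.re) {x : ℝ} (hx : 0 < x) :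
    ‖lkKernel z x‖ ≤ (2 + 3 * ‖z‖ ^ 2) * min 1 (x ^ 2) := by
  have hzx : 0 ≤ (z * x).re := by simp; positivity
  unfold lkKernel trunc
  split_ifs with h
  · refine (norm_exp_neg_sub_one_add_le hzx).trans ?_
    rw [norm_mul, Complex.norm_real, Real.norm_of_nonneg hx.le, min_eq_right (by nlinarith)]
    nlinarith [sq_nonneg x]
  · push Not at h
    rw [min_eq_left (by nlinarith)]
    simp only [Complex.ofReal_zero, mul_zero, add_zero, mul_one]
    calc _ ≤ ‖Complex.exp (-(z * x))‖ + ‖(1 : ℂ)‖ := norm_sub_le _ _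
      _ ≤ 1 + 1 := by gcongr; exacts [norm_exp_neg_le_one hzx, by simp]
      _ ≤ _ := by nlinarith [sq_nonneg ‖z‖]

lemma norm_exp_neg_mul_le {z : ℂ} {d : ℝ} (hz : d ≤ z.re) {x : ℝ} (hx : 0 < x) :
    ‖Complex.exp (-(z * x))‖ ≤ Real.exp (-(d * x)) := by
  rw [Complex.norm_exp, Real.exp_le_exp]
  simp only [Complex.neg_re, Complex.mul_re, Complex.ofReal_re, Complex.ofReal_im, mul_zero,
    sub_zero, neg_le_neg_iff]
  gcongr

lemma mul_exp_neg_le {d x : ℝ} (hd : 0 < d) : x * Real.exp (-(d * x)) ≤ d⁻¹ := by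
  rw [Real.exp_neg, ← div_eq_mul_inv, div_le_iff₀ (Real.exp_pos _), ← div_eq_inv_mul, le_div_iff₀ hd]
  linarith [Real.add_one_le_exp (d * x)]

lemma sq_mul_exp_neg_le {d x : ℝ} (hd : 0 < d) (hx : 0 < x) :
    x ^ 2 * Real.exp (-(d * x)) ≤ 2 / d ^ 2 := by
  rw [Real.exp_neg, ← div_eq_mul_inv, div_le_iff₀ (Real.exp_pos _), div_mul_eq_mul_div,
    le_div_iff₀ (by positivity)]
  have := Real.quadratic_le_exp_of_nonneg (x := d * x) (by positivity)
  nlinarith [mul_pos hd hx]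

/-- Large jumps need not have a first moment; `Re z ≥ d > 0` compensates through `x exp (-d x) ≤ 1 /
d`. -/
lemma norm_lkKernel'_le {z : ℂ} {d : ℝ} (hd : 0 < d) (hz : d ≤ z.re) {x : ℝ} (hx : 0 < x) :
    ‖lkKernel' z x‖ ≤ (2 * ‖z‖ + d⁻¹) * min 1 (x ^ 2) := by
  have hzx : 0 ≤ (z * x).re := by
    have : 0 ≤ z.re := hd.le.trans hz
    simp; positivity
  unfold lkKernel' trunc
  have hd' : 0 < d⁻¹ := by positivity
  split_ifs with h
  · have e : -(x * Complex.exp (-(z * x))) + (x : ℂ) = -(x * (Complex.exp (-(z * x)) - 1)) := by ring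
    rw [e, norm_neg, norm_mul, Complex.norm_real, Real.norm_of_nonneg hx.le,
      min_eq_right (by nlinarith)]
    have := norm_exp_neg_sub_one_le hzx
    rw [norm_mul, Complex.norm_real, Real.norm_of_nonneg hx.le] at this
    nlinarith [norm_nonneg z, sq_nonneg x]
  · push Not at h
    rw [min_eq_left (by nlinarith)]
    simp only [Complex.ofReal_zero, add_zero, mul_one, norm_neg, norm_mul, Complex.norm_real,
      Real.norm_of_nonneg hx.le]
    calc _ ≤ x * Real.exp (-(d * x)) := by gcongr; exact norm_exp_neg_mul_le hz hx
      _ ≤ d⁻¹ := mul_exp_neg_le hd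
      _ ≤ _ := by linarith [norm_nonneg z]

lemma norm_sq_mul_exp_le {z : ℂ} {d : ℝ} (hd : 0 < d) (hz : d ≤ z.re) {x : ℝ} (hx : 0 < x) :
    ‖(x : ℂ) ^ 2 * Complex.exp (-(z * x))‖ ≤ (1 + 2 / d ^ 2) * min 1 (x ^ 2) := by
  rw [norm_mul, norm_pow, Complex.norm_real, Real.norm_of_nonneg hx.le]
  have h1 : x ^ 2 * ‖Complex.exp (-(z * x))‖ ≤ x ^ 2 * Real.exp (-(d * x)) := by
    gcongr; exact norm_exp_neg_mul_le hz hx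
  refine h1.trans ?_
  have hd2 : 0 < 2 / d ^ 2 := by positivity
  rcases le_total 1 (x ^ 2) with h | h
  · rw [min_eq_left h]
    linarith [sq_mul_exp_neg_le hd hx]
  · rw [min_eq_right h]
    have : Real.exp (-(d * x)) ≤ 1 := by rw [Real.exp_le_one_iff]; nlinarith
    nlinarith [sq_nonneg x]

lemma measurable_lkKernel (z : ℂ) : Measurable (lkKernel z) := by
  unfold lkKernel
  have := measurable_trunc
  fun_prop

lemma measurable_lkKernel' (z : ℂ) : Measurable (lkKernel' z) := by
  unfold lkKernel'
  have := measurable_trunc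
  fun_prop

lemma integrable_lkKernel {ρ : Measure ℝ} (hρ : IsLevyOnPos ρ) {z : ℂ} (hz : 0 ≤ z.re) : Integrable (lkKernel z) ρ :=
  hρ.integrable_of_bound (measurable_lkKernel z).aestronglyMeasurable _
    fun _ hx => norm_lkKernel_le hz hx

lemma integrable_lkKernel' {ρ : Measure ℝ} (hρ : IsLevyOnPos ρ) {z : ℂ} (hz : 0 < z.re) : Integrable (lkKernel' z) ρ :=
  hρ.integrable_of_bound (measurable_lkKernel' z).aestronglyMeasurable _
    fun _ hx => norm_lkKernel'_le hz le_rfl hx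

lemma integrable_sq_mul_cexp {ρ : Measure ℝ} (hρ : IsLevyOnPos ρ) {z : ℂ} (hz : 0 < z.re) :
    Integrable (fun x : ℝ => (x : ℂ) ^ 2 * Complex.exp (-(z * x))) ρ :=
  hρ.integrable_of_bound (by fun_prop) _ fun _ hx => norm_sq_mul_exp_le hz le_rfl hx

lemma integrable_sq_mul_exp {ρ : Measure ℝ} (hρ : IsLevyOnPos ρ) {w : ℝ} (hw : 0 < w) :
    Integrable (fun x : ℝ => x ^ 2 * Real.exp (-(w * x))) ρ := by
  have h := (integrable_sq_mul_cexp hρ (z := w) (by simpa using hw)).re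
  refine h.congr (Eventually.of_forall fun x => ?_)
  have : (x : ℂ) ^ 2 * Complex.exp (-(w * x)) = ((x ^ 2 * Real.exp (-(w * x)) : ℝ) : ℂ) := by
    push_cast; rfl
  simp only [this]
  exact Complex.ofReal_re _

lemma continuousOn_integral_lkKernel {ρ : Measure ℝ} (hρ : IsLevyOnPos ρ) :
    ContinuousOn (fun z => ∫ x, lkKernel z x ∂ρ) {z : ℂ | 0 ≤ z.re} := by
  intro z₀ hz₀
  refine continuousWithinAt_of_dominated
    (bound := fun x => (2 + 3 * (‖z₀‖ + 1) ^ 2) * min 1 (x ^ 2)) ?_ ?_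
    (hρ.integrable.const_mul _) ?_
  · exact Eventually.of_forall fun z => (measurable_lkKernel z).aestronglyMeasurable
  · have h1 : ∀ᶠ z in 𝓝[{z : ℂ | 0 ≤ z.re}] z₀, ‖z‖ < ‖z₀‖ + 1 :=
      nhdsWithin_le_nhds (continuous_norm.continuousAt.eventually_lt continuousAt_const (by simp))
    filter_upwards [h1, self_mem_nhdsWithin] with z hz hz0
    filter_upwards [hρ.pos] with x hx
    refine (norm_lkKernel_le hz0 hx).trans ?_
    gcongr
  · refine Eventually.of_forall fun x => ?_
    unfold lkKernel
    fun_prop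

lemma ball_half_re {z₀ z : ℂ} (hz : z ∈ Metric.ball z₀ (z₀.re / 2)) : z₀.re / 2 ≤ z.re := by
  have h1 := Complex.abs_re_le_norm (z - z₀)
  rw [← dist_eq_norm] at h1
  have h2 := h1.trans_lt hz
  rw [Complex.sub_re, abs_lt] at h2
  linarith

lemma norm_le_of_mem_ball {z₀ z : ℂ} {r : ℝ} (hz : z ∈ Metric.ball z₀ r) : ‖z‖ ≤ ‖z₀‖ + r := by
  have h := norm_le_norm_add_norm_sub' z z₀
  have h2 : ‖z - z₀‖ < r := by simpa [dist_eq_norm] using hz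
  linarith

lemma hasDerivAt_integral_lkKernel {ρ : Measure ℝ} (hρ : IsLevyOnPos ρ) {z₀ : ℂ} (hz₀ : 0 < z₀.re) :
    HasDerivAt (fun z => ∫ x, lkKernel z x ∂ρ) (∫ x, lkKernel' z₀ x ∂ρ) z₀ := by
  have hd : 0 < z₀.re / 2 := by positivity
  refine (hasDerivAt_integral_of_dominated_loc_of_deriv_le (s := Metric.ball z₀ (z₀.re / 2))
    (bound := fun x => (2 * (‖z₀‖ + z₀.re / 2) + (z₀.re / 2)⁻¹) * min 1 (x ^ 2))
    (Metric.ball_mem_nhds _ hd)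
    (Eventually.of_forall fun z => (measurable_lkKernel z).aestronglyMeasurable)
    (integrable_lkKernel hρ hz₀.le) (measurable_lkKernel' z₀).aestronglyMeasurable ?_
    (hρ.integrable.const_mul _) ?_).2
  · filter_upwards [hρ.pos] with x hx z hz
    refine (norm_lkKernel'_le hd (ball_half_re hz) hx).trans ?_
    gcongr
    exact norm_le_of_mem_ball hz
  · refine Eventually.of_forall fun x z _ => ?_
    have h1 : HasDerivAt (fun z : ℂ => -(z * x)) (-(1 * x)) z := ((hasDerivAt_id z).mul_const _).neg
    have h2 : HasDerivAt (fun z : ℂ => z * trunc x) (1 * trunc x) z := (hasDerivAt_id z).mul_const _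
    refine ((h1.cexp.sub_const 1).add h2).congr_deriv ?_
    rw [lkKernel']
    ring

lemma hasDerivAt_integral_lkKernel' {ρ : Measure ℝ} (hρ : IsLevyOnPos ρ) {z₀ : ℂ} (hz₀ : 0 < z₀.re) :
    HasDerivAt (fun z => ∫ x, lkKernel' z x ∂ρ)
      (∫ x : ℝ, (x : ℂ) ^ 2 * Complex.exp (-(z₀ * x)) ∂ρ) z₀ := by
  have hd : 0 < z₀.re / 2 := by positivity
  refine (hasDerivAt_integral_of_dominated_loc_of_deriv_le (s := Metric.ball z₀ (z₀.re / 2))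
    (bound := fun x => (1 + 2 / (z₀.re / 2) ^ 2) * min 1 (x ^ 2))
    (F' := fun z x => (x : ℂ) ^ 2 * Complex.exp (-(z * x)))
    (Metric.ball_mem_nhds _ hd)
    (Eventually.of_forall fun z => (measurable_lkKernel' z).aestronglyMeasurable)
    (integrable_lkKernel' hρ hz₀) (by fun_prop) ?_
    (hρ.integrable.const_mul _) ?_).2
  · filter_upwards [hρ.pos] with x hx z hz
    exact norm_sq_mul_exp_le hd (ball_half_re hz) hx
  · refine Eventually.of_forall fun x z _ => ?_
    have h1 : HasDerivAt (fun z : ℂ => -(z * x)) (-(1 * x)) z := ((hasDerivAt_id z).mul_const _).neg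
    refine (((h1.cexp.const_mul (x : ℂ)).neg).add_const (trunc x : ℂ)).congr_deriv ?_
    ring

/-- The Laplace exponent, on the closed right half-plane. -/
noncomputable def lkExp (σ b : ℝ) (ρ : Measure ℝ) (z : ℂ) : ℂ :=
  (σ : ℂ) ^ 2 * z ^ 2 - b * z + ∫ x, lkKernel z x ∂ρ

/-- The derivative of the Laplace exponent on the real half-line. -/
noncomputable def lkDeriv (σ b : ℝ) (ρ : Measure ℝ) (s : ℝ) : ℝ :=
  2 * σ ^ 2 * s - b + ∫ x, (-(x * Real.exp (-(s * x))) + trunc x) ∂ρ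

/-- The second derivative of the Laplace exponent on the real half-line. -/
noncomputable def lkDeriv2 (σ : ℝ) (ρ : Measure ℝ) (s : ℝ) : ℝ :=
  2 * σ ^ 2 + ∫ x : ℝ, x ^ 2 * Real.exp (-(s * x)) ∂ρ

/-- The Laplace exponent on the real half-line. -/
noncomputable def lkReal (σ b : ℝ) (ρ : Measure ℝ) (s : ℝ) : ℝ :=
  σ ^ 2 * s ^ 2 - b * s + ∫ x, (Real.exp (-(s * x)) - 1 + s * trunc x) ∂ρ

lemma neg_charExponent (σ b : ℝ) (ν : Measure ℝ) (ξ : ℝ) :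
    -charExponent σ b ν ξ = lkExp σ b (ν.restrict (Ioi 0)) (-(ξ * Complex.I)) := by
  unfold charExponent lkExp
  have : ∀ x : ℝ, lkKernel (-(ξ * Complex.I)) x = Complex.exp (Complex.I * ξ * x) - 1 -
      Complex.I * ξ * (if x < 1 then (x : ℂ) else 0) := by
    intro x
    unfold lkKernel trunc
    rw [show -(-(ξ * Complex.I) * x) = Complex.I * ξ * x by ring]
    split_ifs <;> push_cast <;> ring
  simp_rw [this]
  rw [neg_sq, mul_pow, Complex.I_sq]
  ring

lemma lkExp_ofReal (σ b : ℝ) (ρ : Measure ℝ) (s : ℝ) : lkExp σ b ρ s = lkReal σ b ρ s := by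
  unfold lkExp lkReal lkKernel
  push_cast
  rw [← integral_complex_ofReal]
  push_cast
  rfl

lemma integral_lkKernel'_ofReal (ρ : Measure ℝ) (s : ℝ) : ∫ x, lkKernel' s x ∂ρ =
    ((∫ x, (-(x * Real.exp (-(s * x))) + trunc x) ∂ρ : ℝ) : ℂ) := by
  rw [← integral_complex_ofReal]
  unfold lkKernel'
  push_cast
  rfl

lemma integral_sq_mul_cexp_ofReal (ρ : Measure ℝ) (s : ℝ) :
    ∫ x : ℝ, (x : ℂ) ^ 2 * Complex.exp (-(s * x)) ∂ρ =
    ((∫ x : ℝ, x ^ 2 * Real.exp (-(s * x)) ∂ρ : ℝ) : ℂ) := by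
  rw [← integral_complex_ofReal]
  push_cast
  rfl

lemma hasDerivAt_lkExp (σ b : ℝ) {ρ : Measure ℝ} (hρ : IsLevyOnPos ρ) {z : ℂ} (hz : 0 < z.re) :
    HasDerivAt (lkExp σ b ρ) (2 * (σ : ℂ) ^ 2 * z - b + ∫ x, lkKernel' z x ∂ρ) z := by
  have h1 : HasDerivAt (fun z : ℂ => (σ : ℂ) ^ 2 * z ^ 2) ((σ : ℂ) ^ 2 * (2 * z)) z := by
    simpa using (hasDerivAt_pow 2 z).const_mul ((σ : ℂ) ^ 2)
  have h2 : HasDerivAt (fun z : ℂ => (b : ℂ) * z) (b * 1) z := (hasDerivAt_id z).const_mul _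
  refine ((h1.sub h2).add (hasDerivAt_integral_lkKernel hρ hz)).congr_deriv ?_
  ring

lemma continuousOn_lkExp (σ b : ℝ) {ρ : Measure ℝ} (hρ : IsLevyOnPos ρ) : ContinuousOn (lkExp σ b ρ) {z | 0 ≤ z.re} := by
  unfold lkExp
  exact (by fun_prop : Continuous fun z : ℂ => (σ : ℂ) ^ 2 * z ^ 2 - b * z).continuousOn.add
    (continuousOn_integral_lkKernel hρ)

lemma halfPlaneHolo_exp_lkExp (σ b : ℝ) {ρ : Measure ℝ} (hρ : IsLevyOnPos ρ) (t : ℝ) :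
    HalfPlaneHolo fun z => Complex.exp (t * lkExp σ b ρ z) where
  continuousOn := (continuousOn_const.mul (continuousOn_lkExp σ b hρ)).cexp
  differentiableAt _ hz := ((hasDerivAt_lkExp σ b hρ hz).differentiableAt.const_mul _).cexp

lemma hasDerivAt_lkReal (σ b : ℝ) {ρ : Measure ℝ} (hρ : IsLevyOnPos ρ) {s : ℝ} (hs : 0 < s) :
    HasDerivAt (lkReal σ b ρ) (lkDeriv σ b ρ s) s := by
  have h := (hasDerivAt_lkExp σ b hρ (z := s) (by simpa using hs)).real_of_complex
  have e : (fun x : ℝ => (lkExp σ b ρ x).re) = lkReal σ b ρ := by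
    ext x; rw [lkExp_ofReal, Complex.ofReal_re]
  rw [e] at h
  convert h using 1
  rw [integral_lkKernel'_ofReal, lkDeriv]
  rw [show (2 * (σ : ℂ) ^ 2 * s - b + ((∫ x, (-(x * Real.exp (-(s * x))) + trunc x) ∂ρ : ℝ) : ℂ)) =
    ((2 * σ ^ 2 * s - b + ∫ x, (-(x * Real.exp (-(s * x))) + trunc x) ∂ρ : ℝ) : ℂ) by push_cast; rfl,
    Complex.ofReal_re]

lemma hasDerivAt_lkDeriv (σ b : ℝ) {ρ : Measure ℝ} (hρ : IsLevyOnPos ρ) {s : ℝ} (hs : 0 < s) :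
    HasDerivAt (lkDeriv σ b ρ) (lkDeriv2 σ ρ s) s := by
  have h := (hasDerivAt_integral_lkKernel' hρ (z₀ := s) (by simpa using hs)).real_of_complex
  simp_rw [integral_lkKernel'_ofReal, integral_sq_mul_cexp_ofReal, Complex.ofReal_re] at h
  have h2 : HasDerivAt (fun s : ℝ => 2 * σ ^ 2 * s - b) (2 * σ ^ 2 * 1) s :=
    ((hasDerivAt_id s).const_mul _).sub_const _
  refine (h2.add h).congr_deriv ?_
  rw [lkDeriv2, mul_one]

lemma continuousOn_lkReal (σ b : ℝ) {ρ : Measure ℝ} (hρ : IsLevyOnPos ρ) : ContinuousOn (lkReal σ b ρ) (Ici 0) := by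
  have h : ContinuousOn (fun s : ℝ => (lkExp σ b ρ s).re) (Ici 0) :=
    Complex.continuous_re.comp_continuousOn
      ((continuousOn_lkExp σ b hρ).comp (by fun_prop) fun s hs => by simpa using hs)
  refine h.congr fun s _ => ?_
  simp only [lkExp_ofReal, Complex.ofReal_re]

lemma lkReal_zero (σ b : ℝ) (ρ : Measure ℝ) : lkReal σ b ρ 0 = 0 := by simp [lkReal]

lemma lkDeriv2_antitone (σ : ℝ) {ρ : Measure ℝ} (hρ : IsLevyOnPos ρ) {s r : ℝ} (hs : 0 < s) (hsr : s ≤ r) : lkDeriv2 σ ρ r ≤ lkDeriv2 σ ρ s := by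
  unfold lkDeriv2
  gcongr 2 * σ ^ 2 + ?_
  refine integral_mono_ae (integrable_sq_mul_exp hρ (hs.trans_le hsr)) (integrable_sq_mul_exp hρ hs) ?_
  filter_upwards [hρ.pos] with x hx
  gcongr

lemma lkDeriv2_nonneg (σ : ℝ) (ρ : Measure ℝ) (s : ℝ) : 0 ≤ lkDeriv2 σ ρ s := by
  unfold lkDeriv2
  have : 0 ≤ ∫ x : ℝ, x ^ 2 * Real.exp (-(s * x)) ∂ρ := integral_nonneg fun x => by positivity
  positivity

/-! ### The exponent on vertical lines: real part and Taylor expansion -/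

lemma re_lkKernel_sub (l u x : ℝ) : (lkKernel l x - lkKernel (l + u * Complex.I) x).re =
    Real.exp (-(l * x)) * (1 - Real.cos (u * x)) := by
  unfold lkKernel
  simp [Complex.exp_re, Complex.mul_re, Complex.mul_im]
  ring

lemma integrable_exp_mul_one_sub_cos {ρ : Measure ℝ} (hρ : IsLevyOnPos ρ) {l : ℝ} (hl : 0 ≤ l) (u : ℝ) :
    Integrable (fun x => Real.exp (-(l * x)) * (1 - Real.cos (u * x))) ρ := by
  have h := ((integrable_lkKernel hρ (z := l) (by simpa using hl)).sub
    (integrable_lkKernel hρ (z := l + u * Complex.I) (by simpa using hl))).re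
  refine h.congr (Eventually.of_forall fun x => ?_)
  simp only [Pi.sub_apply]
  exact re_lkKernel_sub l u x

lemma re_lkExp_vertical (σ b : ℝ) {ρ : Measure ℝ} (hρ : IsLevyOnPos ρ) {l : ℝ} (hl : 0 ≤ l) (u : ℝ) :
    (lkExp σ b ρ (l + u * Complex.I)).re = lkReal σ b ρ l - (σ ^ 2 * u ^ 2 +
      ∫ x, Real.exp (-(l * x)) * (1 - Real.cos (u * x)) ∂ρ) := by
  have i1 := integrable_lkKernel hρ (z := l) (by simpa using hl)
  have i2 := integrable_lkKernel hρ (z := l + u * Complex.I) (by simpa using hl)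
  have h1 : ∫ x, Real.exp (-(l * x)) * (1 - Real.cos (u * x)) ∂ρ =
      (∫ x, lkKernel l x ∂ρ - ∫ x, lkKernel (l + u * Complex.I) x ∂ρ).re := by
    rw [← integral_sub i1 i2]
    simp_rw [← re_lkKernel_sub l u]
    exact integral_re (𝕜 := ℂ) (i1.sub i2)
  have h2 : lkReal σ b ρ l = (lkExp σ b ρ l).re := by rw [lkExp_ofReal, Complex.ofReal_re]
  rw [h1, h2]
  unfold lkExp
  simp [pow_two, Complex.mul_re, Complex.mul_im]
  ring

/-- After factoring out `exp (-w x)`, the integrand is the Taylor remainder of `exp (-iux)`, of size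
`|u x|³`. Half of the exponential absorbs one power of `x`, by `x exp (-w x / 2) ≤ 2 / w`, and
leaves the integrand of the second derivative at `w / 2`; the Gaussian part contributes nothing. -/
lemma lkExp_third_order (σ b : ℝ) {ρ : Measure ℝ} (hρ : IsLevyOnPos ρ) {w : ℝ} (hw : 0 < w) (u : ℝ) :
    ‖lkExp σ b ρ (w + u * Complex.I) - lkReal σ b ρ w - Complex.I * u * lkDeriv σ b ρ w +
      (u : ℂ) ^ 2 / 2 * lkDeriv2 σ ρ w‖ ≤ 8 * |u| ^ 3 / w * lkDeriv2 σ ρ (w / 2) := by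
  have hw0 : 0 ≤ (w : ℂ).re := by simpa using hw.le
  have i1 := integrable_lkKernel hρ (z := w) hw0
  have i2 := integrable_lkKernel hρ (z := w + u * Complex.I) (by simpa using hw.le)
  have i3 := (integrable_lkKernel' hρ (z := w) (by simpa using hw)).const_mul (Complex.I * u)
  have i4 := (integrable_sq_mul_cexp hρ (z := w) (by simpa using hw)).const_mul ((u : ℂ) ^ 2 / 2)
  have e : lkExp σ b ρ (w + u * Complex.I) - lkReal σ b ρ w - Complex.I * u * lkDeriv σ b ρ w +
      (u : ℂ) ^ 2 / 2 * lkDeriv2 σ ρ w = ∫ x : ℝ, (lkKernel (w + u * Complex.I) x - lkKernel w x -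
        Complex.I * u * lkKernel' w x + (u : ℂ) ^ 2 / 2 * ((x : ℂ) ^ 2 * Complex.exp (-(w * x)))) ∂ρ := by
    have j1 := integral_add ((i2.sub i1).sub i3) i4
    have j2 := integral_sub (i2.sub i1) i3
    have j3 := integral_sub i2 i1
    simp only [Pi.sub_apply] at j1 j2 j3
    rw [j1, j2, j3, integral_const_mul, integral_const_mul, ← lkExp_ofReal, integral_lkKernel'_ofReal,
      integral_sq_mul_cexp_ofReal]
    unfold lkExp lkDeriv lkDeriv2
    push_cast
    have : Complex.I ^ 2 = -1 := Complex.I_sq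
    linear_combination ((σ : ℂ) ^ 2 * u ^ 2) * this
  rw [e]
  have hi := (integrable_sq_mul_exp hρ (w := w / 2) (by positivity)).const_mul (8 * |u| ^ 3 / w)
  calc _ ≤ ∫ x, 8 * |u| ^ 3 / w * (x ^ 2 * Real.exp (-(w / 2 * x))) ∂ρ := by
        refine norm_integral_le_of_norm_le hi ?_
        filter_upwards [hρ.pos] with x hx
        have e2 : lkKernel (w + u * Complex.I) x - lkKernel w x - Complex.I * u * lkKernel' w x +
            (u : ℂ) ^ 2 / 2 * ((x : ℂ) ^ 2 * Complex.exp (-(w * x))) = Complex.exp (-(w * x)) *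
            (Complex.exp (-(Complex.I * ((u * x : ℝ) : ℂ))) - 1 + Complex.I * ((u * x : ℝ) : ℂ) +
              ((u * x : ℝ) : ℂ) ^ 2 / 2) := by
          unfold lkKernel lkKernel'
          rw [show -((w + u * Complex.I) * (x : ℂ)) = -(w * x) + -(Complex.I * ((u * x : ℝ) : ℂ)) by
            push_cast; ring, Complex.exp_add]
          push_cast
          ring
        rw [e2, norm_mul]
        have h1 : ‖Complex.exp (-((w : ℂ) * x))‖ = Real.exp (-(w * x)) := by
          rw [Complex.norm_exp]; simp
        rw [h1]
        have h2 := norm_cexp_third_order (u * x)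
        have h3 := mul_exp_neg_le (x := x) (d := w / 2) (by positivity)
        have h4 : Real.exp (-(w * x)) = Real.exp (-(w / 2 * x)) * Real.exp (-(w / 2 * x)) := by
          rw [← Real.exp_add]; congr 1; ring
        calc _ ≤ Real.exp (-(w * x)) * (4 * |u * x| ^ 3) := by gcongr
          _ = (4 * |u| ^ 3 * x ^ 2 * Real.exp (-(w / 2 * x))) * (x * Real.exp (-(w / 2 * x))) := by
              rw [h4, abs_mul, abs_of_pos hx]; ring
          _ ≤ (4 * |u| ^ 3 * x ^ 2 * Real.exp (-(w / 2 * x))) * (w / 2)⁻¹ := by gcongr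
          _ = _ := by field_simp; ring
    _ = 8 * |u| ^ 3 / w * ∫ x : ℝ, x ^ 2 * Real.exp (-(w / 2 * x)) ∂ρ := integral_const_mul _ _
    _ ≤ _ := by
        gcongr
        unfold lkDeriv2
        exact le_add_of_nonneg_left (by positivity)

/-! ### Lower bounds for the energy from weak scaling -/

/-- The real part of `Φ(l) - Φ(l + iu)`. -/
noncomputable def lkEnergy (σ : ℝ) (ρ : Measure ℝ) (l u : ℝ) : ℝ :=
  σ ^ 2 * u ^ 2 + ∫ x, Real.exp (-(l * x)) * (1 - Real.cos (u * x)) ∂ρ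

lemma lkEnergy_nonneg (σ : ℝ) (ρ : Measure ℝ) (l u : ℝ) : 0 ≤ lkEnergy σ ρ l u := by
  have : 0 ≤ ∫ x, Real.exp (-(l * x)) * (1 - Real.cos (u * x)) ∂ρ :=
    integral_nonneg fun x => mul_nonneg (Real.exp_pos _).le (by linarith [Real.cos_le_one (u * x)])
  unfold lkEnergy
  positivity

lemma norm_exp_lkExp (σ b : ℝ) {ρ : Measure ℝ} (hρ : IsLevyOnPos ρ) (t : ℝ) {l : ℝ} (hl : 0 ≤ l)
    (u : ℝ) : ‖Complex.exp (t * lkExp σ b ρ (l + u * Complex.I))‖ =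
      Real.exp (t * (lkReal σ b ρ l - lkEnergy σ ρ l u)) := by
  rw [Complex.norm_exp, Complex.re_ofReal_mul, re_lkExp_vertical σ b hρ hl]
  rfl

/-- The bracket minorises `x² 1_{v x ≤ 1}` by Laplace kernels: it is at most `x²`, and nonpositive
once `v x ≥ 1`, because then `exp (-A v x) ≤ exp (-A/2) exp (-A v x / 2)`. Where `v x ≤ 1`, use `exp
(-l x) ≥ exp (-1)` and `1 - cos y ≥ 2 y² / π²`. -/
lemma energy_pointwise {l u v A x : ℝ} (hlv : l ≤ v) (huv : |u| ≤ v) (hv : 0 < v)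
    (hx : 0 < x) (hA : 2 ≤ A) :
    Real.exp (-1) * (2 / Real.pi ^ 2) * u ^ 2 * (x ^ 2 * Real.exp (-(A * v * x)) -
      Real.exp (-(A / 2)) * (x ^ 2 * Real.exp (-(A * v / 2 * x)))) ≤
      Real.exp (-(l * x)) * (1 - Real.cos (u * x)) := by
  rcases le_total (v * x) 1 with h | h
  · have h1 : Real.exp (-1) ≤ Real.exp (-(l * x)) := by
      rw [Real.exp_le_exp]; nlinarith
    have hux : |u * x| ≤ Real.pi := by
      rw [abs_mul, abs_of_pos hx]
      have : |u| * x ≤ v * x := by gcongr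
      linarith [Real.pi_gt_three]
    have h2 : 2 / Real.pi ^ 2 * (u * x) ^ 2 ≤ 1 - Real.cos (u * x) := by
      linarith [Real.cos_le_one_sub_mul_cos_sq hux]
    have h3 : x ^ 2 * Real.exp (-(A * v * x)) - Real.exp (-(A / 2)) *
        (x ^ 2 * Real.exp (-(A * v / 2 * x))) ≤ x ^ 2 := by
      have e1 : Real.exp (-(A * v * x)) ≤ 1 := by
        rw [Real.exp_le_one_iff]; simp only [Left.neg_nonpos_iff]; positivity
      have e2 : 0 ≤ Real.exp (-(A / 2)) * (x ^ 2 * Real.exp (-(A * v / 2 * x))) := by positivity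
      nlinarith [sq_nonneg x]
    calc _ ≤ Real.exp (-1) * (2 / Real.pi ^ 2) * u ^ 2 * x ^ 2 := by gcongr
      _ = Real.exp (-1) * (2 / Real.pi ^ 2 * (u * x) ^ 2) := by ring
      _ ≤ _ := mul_le_mul h1 h2 (by positivity) (Real.exp_pos _).le
  · have h3 : x ^ 2 * Real.exp (-(A * v * x)) - Real.exp (-(A / 2)) *
        (x ^ 2 * Real.exp (-(A * v / 2 * x))) ≤ 0 := by
      have e1 : Real.exp (-(A * v * x)) ≤ Real.exp (-(A / 2)) * Real.exp (-(A * v / 2 * x)) := by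
        rw [← Real.exp_add, Real.exp_le_exp]
        nlinarith
      nlinarith [mul_le_mul_of_nonneg_left e1 (sq_nonneg x)]
    have h4 : 0 ≤ Real.exp (-(l * x)) * (1 - Real.cos (u * x)) :=
      mul_nonneg (Real.exp_pos _).le (by linarith [Real.cos_le_one (u * x)])
    have h5 : 0 ≤ Real.exp (-1) * (2 / Real.pi ^ 2) * u ^ 2 := by positivity
    nlinarith

lemma lkEnergy_ge_sub {σ : ℝ} {ρ : Measure ℝ} (hρ : IsLevyOnPos ρ) {l u v A : ℝ} (hl : 0 ≤ l)
    (hlv : l ≤ v) (huv : |u| ≤ v) (hv : 0 < v) (hA : 2 ≤ A) :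
    Real.exp (-1) * (2 / Real.pi ^ 2) * u ^ 2 * (lkDeriv2 σ ρ (A * v) -
      Real.exp (-(A / 2)) * lkDeriv2 σ ρ (A * v / 2)) ≤ lkEnergy σ ρ l u := by
  have hA0 : 0 < A := by linarith
  set k := Real.exp (-1) * (2 / Real.pi ^ 2) with hk
  have hk0 : 0 ≤ k := by positivity
  -- Needed for the Gaussian part: it enters `lkDeriv2` as `2 σ²` but `lkEnergy` only as `σ² u²`.
  have hk2 : k ≤ 1 / 2 := by
    have h1 : Real.exp (-1) ≤ 1 := by rw [Real.exp_le_one_iff]; norm_num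
    have h2 : 2 / Real.pi ^ 2 ≤ 1 / 2 := by
      rw [div_le_div_iff₀ (by positivity) (by norm_num)]
      nlinarith [Real.pi_gt_three]
    calc k ≤ 1 * (1 / 2) := mul_le_mul h1 h2 (by positivity) zero_le_one
      _ = 1 / 2 := one_mul _
  have i1 := integrable_sq_mul_exp hρ (w := A * v) (by positivity)
  have i2 := (integrable_sq_mul_exp hρ (w := A * v / 2) (by positivity)).const_mul (Real.exp (-(A / 2)))
  have h := integral_mono_ae ((i1.sub i2).const_mul (k * u ^ 2)) (integrable_exp_mul_one_sub_cos hρ hl u)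
    (hρ.pos.mono fun x hx => energy_pointwise hlv huv hv hx hA)
  have j := integral_sub i1 i2
  simp only [Pi.sub_apply] at h
  rw [integral_const_mul, j, integral_const_mul] at h
  unfold lkEnergy lkDeriv2
  have h2 : 0 ≤ σ ^ 2 * u ^ 2 := by positivity
  have h3 : k * (σ ^ 2 * u ^ 2) ≤ 1 / 2 * (σ ^ 2 * u ^ 2) := by gcongr
  have h4 : 0 ≤ k * (σ ^ 2 * u ^ 2) * Real.exp (-(A / 2)) := by positivity
  nlinarith

/-- Weak lower scaling, in quotient form. -/
lemma WLSC.le_of_le {f : ℝ → ℝ} {τ c x₀ : ℝ} (h : WLSC f τ c x₀) (hx₀ : 0 ≤ x₀) {x y : ℝ}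
    (hx : x₀ < x) (hxy : x ≤ y) : c * (y / x) ^ τ * f x ≤ f y := by
  have hx0 : 0 < x := hx₀.trans_lt hx
  have := h (y / x) x ((one_le_div hx0).2 hxy) hx
  rwa [div_mul_cancel₀ _ hx0.ne'] at this

lemma WLSC.half_le {f : ℝ → ℝ} {τ c x₀ : ℝ} (h : WLSC f τ c x₀) (hc : 0 < c) (hx₀ : 0 ≤ x₀)
    {x : ℝ} (hx : 2 * x₀ < x) : f (x / 2) ≤ (c * 2 ^ τ)⁻¹ * f x := by
  have := h.le_of_le hx₀ (x := x / 2) (y := x) (by linarith) (by linarith)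
  rw [show x / (x / 2) = 2 by field_simp [show x ≠ 0 by linarith]] at this
  rw [← div_eq_inv_mul, le_div_iff₀ (by positivity)]
  linarith

lemma exists_lkEnergy_ge {σ : ℝ} {ρ : Measure ℝ} (hρ : IsLevyOnPos ρ) {τ c x₀ : ℝ}
    (hc : 0 < c) (hx₀ : 0 ≤ x₀) (hs : WLSC (lkDeriv2 σ ρ) τ c x₀) :
    ∃ κ : ℝ, 0 < κ ∧ ∀ l u v : ℝ, 0 ≤ l → l ≤ v → |u| ≤ v → x₀ < v →
      κ * u ^ 2 * lkDeriv2 σ ρ v ≤ lkEnergy σ ρ l u := by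
  -- `q` is twice the constant of `WLSC.half_le`, and `A` satisfies `exp (-A/2) ≤ 1/q`, so the
  -- subtracted term is at most half of the main one.
  set q : ℝ := 2 * (c * 2 ^ τ)⁻¹ with hq
  have hq0 : 0 < q := by positivity
  set A : ℝ := max 2 (2 * Real.log q) with hA
  have hA2 : 2 ≤ A := le_max_left _ _
  have hA0 : 0 < A := by linarith
  have hAq : Real.exp (-(A / 2)) ≤ q⁻¹ := by
    rw [← Real.exp_log (inv_pos.2 hq0), Real.log_inv, Real.exp_le_exp]
    have : 2 * Real.log q ≤ A := le_max_right _ _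
    linarith
  refine ⟨Real.exp (-1) * (2 / Real.pi ^ 2) * (c * A ^ τ / 2), by positivity, ?_⟩
  intro l u v hl hlv huv hv
  have hv0 : 0 < v := hx₀.trans_lt hv
  refine le_trans ?_ (lkEnergy_ge_sub hρ hl hlv huv hv0 hA2)
  have h1 : lkDeriv2 σ ρ (A * v / 2) ≤ (c * 2 ^ τ)⁻¹ * lkDeriv2 σ ρ (A * v) :=
    hs.half_le hc hx₀ (by nlinarith)
  have h2 : c * A ^ τ * lkDeriv2 σ ρ v ≤ lkDeriv2 σ ρ (A * v) := hs A v (by linarith) hv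
  have h3 : Real.exp (-(A / 2)) * lkDeriv2 σ ρ (A * v / 2) ≤ lkDeriv2 σ ρ (A * v) / 2 := by
    have hn := lkDeriv2_nonneg σ ρ (A * v)
    calc _ ≤ q⁻¹ * ((c * 2 ^ τ)⁻¹ * lkDeriv2 σ ρ (A * v)) :=
          mul_le_mul hAq h1 (lkDeriv2_nonneg _ _ _) (by positivity)
      _ = _ := by rw [hq]; field_simp
  calc _ = Real.exp (-1) * (2 / Real.pi ^ 2) * u ^ 2 * (c * A ^ τ * lkDeriv2 σ ρ v / 2) := by ring
    _ ≤ _ := by gcongr; linarith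

/-- For `|u| ≥ w` the quadratic bound is applied at scale `|u|` and carried back to `w` by scaling:
`u² (|u|/w)^(α-2) = w² (|u|/w)^α ≥ w |u|` since `α > 1`. -/
lemma exists_lkEnergy_bounds {σ : ℝ} {ρ : Measure ℝ} (hρ : IsLevyOnPos ρ) {α c x₀ : ℝ}
    (hα : 1 < α) (hc : 0 < c) (hx₀ : 0 ≤ x₀) (hs : WLSC (lkDeriv2 σ ρ) (α - 2) c x₀) :
    ∃ κ : ℝ, 0 < κ ∧
      (∀ w u : ℝ, x₀ < w → |u| ≤ w → κ * u ^ 2 * lkDeriv2 σ ρ w ≤ lkEnergy σ ρ w u) ∧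
      ∀ l w u : ℝ, 0 ≤ l → x₀ < w → l ≤ |u| → w ≤ |u| →
        κ * (w * |u|) * lkDeriv2 σ ρ w ≤ lkEnergy σ ρ l u := by
  obtain ⟨κ, hκ, h⟩ := exists_lkEnergy_ge hρ hc hx₀ hs
  refine ⟨min κ (κ * c), by positivity, ?_, ?_⟩
  · intro w u hw hu
    refine le_trans ?_ (h w u w (hx₀.trans hw.le) le_rfl hu hw)
    have := lkDeriv2_nonneg σ ρ w
    gcongr
    exact min_le_left _ _
  · intro l w u hl hw hlu hwu
    have hw0 : 0 < w := hx₀.trans_lt hw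
    have hg := lkDeriv2_nonneg σ ρ w
    have h1 := h l u |u| hl hlu le_rfl (hw.trans_le hwu)
    have h2 := hs.le_of_le hx₀ hw hwu
    have h3 : w * |u| ≤ u ^ 2 * (|u| / w) ^ (α - 2) := by
      have hr : 1 ≤ |u| / w := (one_le_div hw0).2 hwu
      have e : u ^ 2 = w ^ 2 * (|u| / w) ^ (2 : ℝ) := by
        rw [Real.rpow_two, div_pow, sq_abs]; field_simp
      rw [e, mul_assoc, ← Real.rpow_add (by positivity)]
      calc w * |u| = w ^ 2 * (|u| / w) ^ (1 : ℝ) := by rw [Real.rpow_one]; field_simp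
        _ ≤ _ := by gcongr; linarith
    calc min κ (κ * c) * (w * |u|) * lkDeriv2 σ ρ w
        ≤ κ * c * (u ^ 2 * (|u| / w) ^ (α - 2)) * lkDeriv2 σ ρ w := by
          gcongr; exact min_le_right _ _
      _ = κ * u ^ 2 * (c * (|u| / w) ^ (α - 2) * lkDeriv2 σ ρ w) := by ring
      _ ≤ κ * u ^ 2 * lkDeriv2 σ ρ |u| := by gcongr
      _ ≤ _ := h1

lemma exists_lkReal_le (σ b : ℝ) {ρ : Measure ℝ} (hρ : IsLevyOnPos ρ) (w : ℝ) :
    ∃ K, 0 ≤ K ∧ ∀ l ∈ Icc 0 w, lkReal σ b ρ l ≤ K := by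
  obtain ⟨K, hK⟩ := (isCompact_Icc (a := (0 : ℝ)) (b := w)).bddAbove_image
    ((continuousOn_lkReal σ b hρ).mono Icc_subset_Ici_self)
  exact ⟨max K 0, le_max_right _ _, fun l hl => (hK (mem_image_of_mem _ hl)).trans (le_max_left _ _)⟩

/-- The linear energy bound, taken at the fixed reference point `x₀ + 1`, is uniform over the strip
once `|u|` exceeds both `w` and `x₀ + 1`. -/
lemma stripDecay_exp_lkExp {σ b : ℝ} {ρ : Measure ℝ} (hρ : IsLevyOnPos ρ) {α c x₀ : ℝ}
    (hα : 1 < α) (hc : 0 < c) (hx₀ : 0 ≤ x₀) (hs : WLSC (lkDeriv2 σ ρ) (α - 2) c x₀)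
    (hpos : ∀ s, 0 < s → 0 < lkDeriv2 σ ρ s) {t : ℝ} (ht : 0 < t) :
    StripDecay fun z => Complex.exp (t * lkExp σ b ρ z) := by
  obtain ⟨κ, hκ, -, h⟩ := exists_lkEnergy_bounds hρ hα hc hx₀ hs
  intro w hw
  obtain ⟨K, hK0, hK⟩ := exists_lkReal_le σ b hρ w
  have hx1 : 0 < x₀ + 1 := by linarith
  set a := κ * (x₀ + 1) * lkDeriv2 σ ρ (x₀ + 1) with ha
  have ha0 : 0 < a := by have := hpos _ hx1; positivity
  set m := max w (x₀ + 1) with hm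
  have hm0 : 0 < m := hx1.trans_le (le_max_right _ _)
  have hE : ∀ l ∈ Icc 0 w, ∀ u, a * (|u| - m) ≤ lkEnergy σ ρ l u := by
    intro l hl u
    rcases le_total |u| m with hu | hu
    · refine le_trans ?_ (lkEnergy_nonneg σ ρ l u)
      nlinarith
    · have := h l (x₀ + 1) u hl.1 (by linarith) (hl.2.trans ((le_max_left _ _).trans hu))
        ((le_max_right _ _).trans hu)
      refine le_trans ?_ this
      rw [show κ * ((x₀ + 1) * |u|) * lkDeriv2 σ ρ (x₀ + 1) = a * |u| by rw [ha]; ring]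
      gcongr
      linarith
  refine ⟨Real.exp (t * (K + a * m)), t * a, by positivity, fun l hl u => ?_⟩
  rw [norm_exp_lkExp σ b hρ t hl.1, ← Real.exp_add, Real.exp_le_exp]
  nlinarith [hE l hl u, hK l hl]

/-- Nonnegativity of the energy bounds `exp (t Φ)` on strips by its values on the real axis, so this
identification needs no scaling. -/
lemma exp_moment_lk (μ : Measure ℝ) [IsProbabilityMeasure μ] {σ b : ℝ} {ρ : Measure ℝ}
    (hρ : IsLevyOnPos ρ) (t : ℝ) (ht : 0 ≤ t)
    (hμ : ∀ ξ : ℝ, charFun μ ξ = Complex.exp (t * lkExp σ b ρ (-(ξ * Complex.I)))) {w : ℝ}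
    (hw : 0 ≤ w) : ∫ x, Real.exp (-w * x) ∂μ = Real.exp (t * lkReal σ b ρ w) := by
  have h := (exp_moment_of_bounded μ (halfPlaneHolo_exp_lkExp σ b hρ t) ?_ hμ hw).2
  · rw [integral_complex_ofReal, lkExp_ofReal] at h
    exact_mod_cast h
  · intro w hw
    obtain ⟨K, hK0, hK⟩ := exists_lkReal_le σ b hρ w
    refine ⟨Real.exp (t * K), fun l hl u => ?_⟩
    rw [norm_exp_lkExp σ b hρ t hl.1, Real.exp_le_exp]
    gcongr
    linarith [hK l hl, lkEnergy_nonneg σ ρ l u]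

/-! ### From the process to its exponent; non-degeneracy -/

section Paths

variable {Ω : Type*} [MeasurableSpace Ω]

lemma IsSpectrallyPositiveLevy.charFun_lk {P : Measure Ω} {X : ℝ≥0 → Ω → ℝ} {σ b : ℝ}
    {ν : Measure ℝ} (hX : IsSpectrallyPositiveLevy X P σ b ν) (t : ℝ≥0) (ξ : ℝ) :
    charFun (P.map (X t)) ξ =
      Complex.exp ((t : ℝ) * lkExp σ b (ν.restrict (Ioi 0)) (-(ξ * Complex.I))) := by
  rw [hX.charFun_eq, ← neg_charExponent]
  congr 1
  ring

lemma IsSpectrallyPositiveLevy.laplaceExponent_eq {P : Measure Ω} [IsProbabilityMeasure P]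
    {X : ℝ≥0 → Ω → ℝ} {σ b : ℝ} {ν : Measure ℝ} (hX : IsSpectrallyPositiveLevy X P σ b ν) {w : ℝ}
    (hw : 0 ≤ w) : laplaceExponent X P w = lkReal σ b (ν.restrict (Ioi 0)) w := by
  have : IsProbabilityMeasure (P.map (X 1)) :=
    Measure.isProbabilityMeasure_map (hX.measurable 1).aemeasurable
  have h := exp_moment_lk (P.map (X 1)) hX.levyMeasure.isLevyOnPos 1 zero_le_one
    (by simpa using hX.charFun_lk 1) hw
  rw [integral_map (hX.measurable 1).aemeasurable (by fun_prop), one_mul] at h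
  rw [laplaceExponent, cgf, mgf, h, Real.log_exp]

lemma eq_linear_of_rightCont {f : ℝ≥0 → ℝ} {b : ℝ} {D : Set ℝ≥0} (hD : Dense D)
    (hf : ∀ t, ContinuousWithinAt f (Ici t) t) (h : ∀ t ∈ D, f t = t * b) (t : ℝ≥0) :
    f t = t * b := by
  have hcl : t ∈ closure (Ioi t ∩ D) := by
    have h1 : t ∈ closure (Ioi t) := by rw [closure_Ioi' (nonempty_Ioi)]; exact self_mem_Ici
    have h2 := hD.open_subset_closure_inter (isOpen_Ioi (a := t))
    exact closure_minimal h2 isClosed_closure h1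
  have hne : (𝓝[Ioi t ∩ D] t).NeBot := mem_closure_iff_nhdsWithin_neBot.1 hcl
  have h1 : Tendsto f (𝓝[Ioi t ∩ D] t) (𝓝 (f t)) :=
    (hf t).mono_left (nhdsWithin_mono _ (inter_subset_left.trans Ioi_subset_Ici_self))
  have h2 : Tendsto (fun s : ℝ≥0 => (s : ℝ) * b) (𝓝[Ioi t ∩ D] t) (𝓝 (t * b)) :=
    ((by fun_prop : Continuous fun s : ℝ≥0 => (s : ℝ) * b).tendsto t).mono_left nhdsWithin_le_nhds
  refine tendsto_nhds_unique (h1.congr' ?_) h2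
  filter_upwards [self_mem_nhdsWithin] with s hs using h s hs.2

lemma locallyBoundedVariationOn_linear (b : ℝ) :
    LocallyBoundedVariationOn (fun t : ℝ≥0 => (t : ℝ) * b) univ := by
  have h1 : LocallyBoundedVariationOn (fun t : ℝ≥0 => (t : ℝ)) univ :=
    MonotoneOn.locallyBoundedVariationOn fun s _ t _ hst => hst
  have h2 : LipschitzWith ‖b‖₊ fun x : ℝ => x * b := by
    refine LipschitzWith.of_dist_le_mul fun x y => ?_
    rw [Real.dist_eq, ← sub_mul, abs_mul, mul_comm, Real.dist_eq]
    rfl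
  exact h2.comp_locallyBoundedVariationOn h1

/-- If `φ''` vanished at one point, then `σ = 0` and there would be no jumps, so `X t = t b` almost
surely for each `t`. A countable dense set of times and right-continuity make whole paths linear,
hence of bounded variation. -/
lemma IsSpectrallyPositiveLevy.lkDeriv2_pos {P : Measure Ω} [IsProbabilityMeasure P]
    {X : ℝ≥0 → Ω → ℝ} {σ b : ℝ} {ν : Measure ℝ} (hX : IsSpectrallyPositiveLevy X P σ b ν)
    (hvar : UnboundedVariation X P) {s : ℝ} (hs : 0 < s) :
    0 < lkDeriv2 σ (ν.restrict (Ioi 0)) s := by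
  have hρ := hX.levyMeasure.isLevyOnPos
  set ρ := ν.restrict (Ioi 0) with hρd
  refine (lkDeriv2_nonneg σ ρ s).lt_of_ne' fun h0 => hvar ?_
  unfold lkDeriv2 at h0
  have hn : 0 ≤ ∫ x : ℝ, x ^ 2 * Real.exp (-(s * x)) ∂ρ := integral_nonneg fun x => by positivity
  have hσ : σ = 0 := by
    have : σ ^ 2 = 0 := le_antisymm (by nlinarith) (sq_nonneg σ)
    exact pow_eq_zero_iff two_ne_zero |>.1 this
  have hi : ∫ x : ℝ, x ^ 2 * Real.exp (-(s * x)) ∂ρ = 0 := by nlinarith [sq_nonneg σ]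
  have hρ0 : ρ = 0 := by
    rw [integral_eq_zero_iff_of_nonneg (fun x => by positivity) (integrable_sq_mul_exp hρ hs)] at hi
    rw [← ae_eq_bot, ← empty_mem_iff_bot]
    filter_upwards [hi, hρ.pos] with x hx hx0
    have : 0 < x ^ 2 * Real.exp (-(s * x)) := by positivity
    exact this.ne' hx
  have hdet : ∀ t : ℝ≥0, ∀ᵐ ω ∂P, X t ω = t * b := by
    intro t
    have : IsProbabilityMeasure (P.map (X t)) :=
      Measure.isProbabilityMeasure_map (hX.measurable t).aemeasurable
    have h1 : P.map (X t) = Measure.dirac (t * b : ℝ) := by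
      refine Measure.ext_of_charFun ?_
      ext ξ
      rw [hX.charFun_lk, ← hρd, hρ0, hσ, charFun_dirac, lkExp]
      congr 1
      simp
      ring
    have h2 : ∀ᵐ y ∂(P.map (X t)), y = t * b := by
      rw [h1, ae_dirac_iff (measurableSet_eq)]
    exact ae_of_ae_map (hX.measurable t).aemeasurable h2
  obtain ⟨D, hDc, hDd⟩ := TopologicalSpace.exists_countable_dense ℝ≥0
  have hall : ∀ᵐ ω ∂P, ∀ t ∈ D, X t ω = t * b := (ae_ball_iff hDc).2 fun t _ => hdet t
  filter_upwards [hall, hX.cadlag] with ω h1 h2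
  have : (fun t => X t ω) = fun t : ℝ≥0 => (t : ℝ) * b :=
    funext fun t => eq_linear_of_rightCont hDd (fun t => (h2 t).1) h1 t
  rw [this]
  exact locallyBoundedVariationOn_linear b

end Paths

/-! ### Convex analysis of the Laplace exponent -/

/-- The analytic properties of a Laplace exponent on `[0, ∞)`: it vanishes at `0`, it is strictly
convex, and its second derivative decreases. -/
structure IsConvexExponent (φ : ℝ → ℝ) : Prop where
  continuousOn : ContinuousOn φ (Ici 0)
  zero : φ 0 = 0
  hasDerivAt : ∀ s, 0 < s → HasDerivAt φ (deriv φ s) s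
  hasDerivAt_deriv : ∀ s, 0 < s → HasDerivAt (deriv φ) (deriv (deriv φ) s) s
  deriv2_pos : ∀ s, 0 < s → 0 < deriv (deriv φ) s
  deriv2_anti : ∀ s r, 0 < s → s ≤ r → deriv (deriv φ) r ≤ deriv (deriv φ) s

namespace IsConvexExponent

variable {φ : ℝ → ℝ}

lemma exists_slope (h : IsConvexExponent φ) {a b : ℝ} (ha : 0 ≤ a) (hab : a < b) :
    ∃ ξ ∈ Ioo a b, φ b - φ a = deriv φ ξ * (b - a) := by
  obtain ⟨ξ, hξ, he⟩ := exists_hasDerivAt_eq_slope φ (deriv φ) hab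
    (h.continuousOn.mono fun x hx => ha.trans hx.1) fun x hx => h.hasDerivAt x (ha.trans_lt hx.1)
  refine ⟨ξ, hξ, ?_⟩
  rw [he, div_mul_cancel₀]
  linarith

lemma exists_slope_deriv (h : IsConvexExponent φ) {a b : ℝ} (ha : 0 < a) (hab : a < b) :
    ∃ ξ ∈ Ioo a b, deriv φ b - deriv φ a = deriv (deriv φ) ξ * (b - a) := by
  obtain ⟨ξ, hξ, he⟩ := exists_hasDerivAt_eq_slope (deriv φ) (deriv (deriv φ)) hab
    (fun x hx => (h.hasDerivAt_deriv x (ha.trans_le hx.1)).continuousAt.continuousWithinAt)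
    fun x hx => h.hasDerivAt_deriv x (ha.trans hx.1)
  refine ⟨ξ, hξ, ?_⟩
  rw [he, div_mul_cancel₀]
  linarith

lemma deriv_strictMono (h : IsConvexExponent φ) {a b : ℝ} (ha : 0 < a) (hab : a < b) :
    deriv φ a < deriv φ b := by
  obtain ⟨ξ, hξ, he⟩ := h.exists_slope_deriv ha hab
  have := mul_pos (h.deriv2_pos ξ (ha.trans hξ.1)) (sub_pos.2 hab)
  linarith

lemma deriv_mono (h : IsConvexExponent φ) {a b : ℝ} (ha : 0 < a) (hab : a ≤ b) :
    deriv φ a ≤ deriv φ b := by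
  rcases hab.eq_or_lt with rfl | hab
  exacts [le_rfl, (h.deriv_strictMono ha hab).le]

lemma deriv_sub_le (h : IsConvexExponent φ) {a b : ℝ} (ha : 0 < a) (hab : a < b) :
    deriv φ b - deriv φ a ≤ deriv (deriv φ) a * (b - a) := by
  obtain ⟨ξ, hξ, he⟩ := h.exists_slope_deriv ha hab
  rw [he]
  exact mul_le_mul_of_nonneg_right (h.deriv2_anti a ξ ha hξ.1.le) (sub_pos.2 hab).le

lemma le_deriv_sub (h : IsConvexExponent φ) {a b : ℝ} (ha : 0 < a) (hab : a < b) :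
    deriv (deriv φ) b * (b - a) ≤ deriv φ b - deriv φ a := by
  obtain ⟨ξ, hξ, he⟩ := h.exists_slope_deriv ha hab
  rw [he]
  exact mul_le_mul_of_nonneg_right (h.deriv2_anti ξ b (ha.trans hξ.1) hξ.2.le) (sub_pos.2 hab).le

lemma le_sub (h : IsConvexExponent φ) {a b : ℝ} (ha : 0 < a) (hab : a < b) :
    deriv φ a * (b - a) ≤ φ b - φ a := by
  obtain ⟨ξ, hξ, he⟩ := h.exists_slope ha.le hab
  rw [he]
  exact mul_le_mul_of_nonneg_right (h.deriv_strictMono ha hξ.1).le (sub_pos.2 hab).le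

/-- `φ'` is unbounded above. -/
def DerivUnbounded (φ : ℝ → ℝ) : Prop := ∀ y a, ∃ s, a < s ∧ 0 < s ∧ y < deriv φ s

/-- As `φ''` decreases, `φ'(Rx) ≥ φ'(x) + (Rx/2) φ''(Rx)`, and scaling makes the last term at least
a multiple of `R^(α-1)`. -/
lemma derivUnbounded (h : IsConvexExponent φ) {α c x₀ : ℝ} (hα : 1 < α) (hc : 0 < c)
    (hx₀ : 0 ≤ x₀) (hs : WLSC (deriv (deriv φ)) (α - 2) c x₀) :
    DerivUnbounded φ := by
  intro y a
  set x := x₀ + 1 with hx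
  have hx0 : 0 < x := by linarith
  have hg := h.deriv2_pos x hx0
  set k := c * x / 2 * deriv (deriv φ) x with hk
  have hk0 : 0 < k := by positivity
  have hT : Tendsto (fun R : ℝ => R ^ (α - 1)) atTop atTop := tendsto_rpow_atTop (by linarith)
  obtain ⟨R, hR1, hR2, hR3⟩ := ((hT.eventually_gt_atTop ((y - deriv φ x) / k)).and
    ((eventually_ge_atTop (2 : ℝ)).and (eventually_gt_atTop (a / x)))).exists
  have hR0 : 0 < R := by linarith
  refine ⟨R * x, (div_lt_iff₀ hx0).1 hR3, by positivity, ?_⟩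
  have h1 := hs R x (by linarith) (by linarith)
  have h2 := h.le_deriv_sub (a := R * x / 2) (b := R * x) (by positivity) (by linarith [mul_pos hR0 hx0])
  have h3 := h.deriv_mono (a := x) (b := R * x / 2) hx0 (by nlinarith)
  rw [div_lt_iff₀ hk0] at hR1
  have e : R ^ (α - 1) = R * R ^ (α - 2) := by
    rw [show α - 1 = 1 + (α - 2) by ring, Real.rpow_add hR0, Real.rpow_one]
  have h4 : R ^ (α - 1) * k ≤ deriv (deriv φ) (R * x) * (R * x - R * x / 2) := by
    rw [e, hk]
    calc R * R ^ (α - 2) * (c * x / 2 * deriv (deriv φ) x)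
        = (c * R ^ (α - 2) * deriv (deriv φ) x) * (R * x / 2) := by ring
      _ ≤ deriv (deriv φ) (R * x) * (R * x / 2) := by gcongr
      _ = _ := by ring
  linarith

lemma exists_gt (h : IsConvexExponent φ) (hu : DerivUnbounded φ) (y a : ℝ) :
    ∃ s, a < s ∧ 0 < s ∧ ∀ r, s ≤ r → y < φ r := by
  obtain ⟨q, -, hq0, hq⟩ := hu 1 0
  refine ⟨max (max (a + 1) (q + 1)) (q + (y - φ q) + 1), ?_, ?_, ?_⟩
  · exact lt_max_of_lt_left (lt_max_of_lt_left (by linarith))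
  · exact lt_max_of_lt_left (lt_max_of_lt_right (by linarith))
  · intro r hr
    have h1 : q + 1 ≤ r := ((le_max_right _ _).trans (le_max_left _ _)).trans hr
    have h2 : q + (y - φ q) + 1 ≤ r := (le_max_right _ _).trans hr
    have := h.le_sub hq0 (b := r) (by linarith)
    nlinarith

lemma bddAbove_roots (h : IsConvexExponent φ) (hu : DerivUnbounded φ) :
    BddAbove {s | 0 ≤ s ∧ φ s = 0} := by
  obtain ⟨s, -, -, hs⟩ := h.exists_gt hu 0 0
  refine ⟨s, fun r hr => ?_⟩
  by_contra! hsr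
  exact (hs r hsr.le).ne' hr.2

lemma theta0_mem (h : IsConvexExponent φ) (hu : DerivUnbounded φ) :
    0 ≤ theta0 φ ∧ φ (theta0 φ) = 0 := by
  have hcl : IsClosed {s | 0 ≤ s ∧ φ s = 0} := by
    have := h.continuousOn.preimage_isClosed_of_isClosed isClosed_Ici (isClosed_singleton (x := (0 : ℝ)))
    exact this
  exact hcl.csSup_mem ⟨0, le_rfl, h.zero⟩ (h.bddAbove_roots hu)

lemma pos_of_theta0_lt (h : IsConvexExponent φ) (hu : DerivUnbounded φ) {s : ℝ}
    (hs : theta0 φ < s) : 0 < φ s := by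
  have h0 := (h.theta0_mem hu).1
  by_contra! hn
  obtain ⟨r, hsr, hr0, hr⟩ := h.exists_gt hu 0 s
  have hc : ContinuousOn φ (Icc s r) := h.continuousOn.mono fun x hx => by
    simp only [mem_Ici]; linarith [hx.1]
  obtain ⟨x, hx, hx0⟩ := intermediate_value_Icc hsr.le hc ⟨hn, (hr r le_rfl).le⟩
  have := le_csSup (h.bddAbove_roots hu) (show x ∈ {s | 0 ≤ s ∧ φ s = 0} from ⟨by linarith [hx.1], hx0⟩)
  have h2 : x ≤ theta0 φ := this
  linarith [hx.1]

/-- A positive value between the roots `0` and `θ₀` would need a positive slope followed by a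
negative one, against convexity. -/
lemma nonpos_of_le_theta0 (h : IsConvexExponent φ) (hu : DerivUnbounded φ) {s : ℝ}
    (hs0 : 0 < s) (hs : s ≤ theta0 φ) : φ s ≤ 0 := by
  obtain ⟨h0, h1⟩ := h.theta0_mem hu
  rcases hs.eq_or_lt with rfl | hs
  · exact h1.le
  by_contra! hn
  obtain ⟨ξ, hξ, he⟩ := h.exists_slope le_rfl hs0
  obtain ⟨η, hη, hf⟩ := h.exists_slope hs0.le hs
  rw [h.zero] at he
  rw [h1] at hf
  have := h.deriv_strictMono hξ.1 (hξ.2.trans hη.1)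
  have h2 : 0 < deriv φ ξ := by
    by_contra! hn'
    nlinarith
  nlinarith

lemma deriv_pos_of_theta0_lt (h : IsConvexExponent φ) (hu : DerivUnbounded φ) {s : ℝ}
    (hs : theta0 φ < s) : 0 < deriv φ s := by
  obtain ⟨h0, h1⟩ := h.theta0_mem hu
  obtain ⟨ξ, hξ, he⟩ := h.exists_slope h0 hs
  have := h.pos_of_theta0_lt hu hs
  have h2 := h.deriv_strictMono (h0.trans_lt hξ.1) hξ.2
  rw [h1] at he
  by_contra! hn
  nlinarith [hξ.1, hξ.2]

lemma strictMono_of_theta0_lt (h : IsConvexExponent φ) (hu : DerivUnbounded φ) {s r : ℝ}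
    (hs : theta0 φ < s) (hsr : s < r) : φ s < φ r := by
  have h0 := (h.theta0_mem hu).1
  have := h.le_sub (h0.trans_lt hs) hsr
  nlinarith [h.deriv_pos_of_theta0_lt hu hs]

lemma _root_.SpecPos.posInv_eq_of_unique {f : ℝ → ℝ} {y r : ℝ} (hr : 0 < r) (hfr : f r = y)
    (hu : ∀ s, 0 < s → f s = y → s = r) : posInv f y = r := by
  have : {s | 0 < s ∧ f s = y} = {r} := by
    ext s
    exact ⟨fun hs => hu s hs.1 hs.2, fun hs => by rw [mem_singleton_iff.1 hs]; exact ⟨hr, hfr⟩⟩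
  rw [posInv, this, csSup_singleton]

lemma posInv_spec (h : IsConvexExponent φ) (hu : DerivUnbounded φ) {y : ℝ} (hy : 0 < y) :
    theta0 φ < posInv φ y ∧ φ (posInv φ y) = y := by
  obtain ⟨s, -, hs0, hs⟩ := h.exists_gt hu y 0
  obtain ⟨r, hr, hry⟩ := intermediate_value_Icc hs0.le (h.continuousOn.mono Icc_subset_Ici_self)
    (show y ∈ Icc (φ 0) (φ s) from ⟨by rw [h.zero]; exact hy.le, (hs s le_rfl).le⟩)
  have key : ∀ q, 0 < q → φ q = y → theta0 φ < q := by
    intro q hq0 hq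
    by_contra! hn
    linarith [h.nonpos_of_le_theta0 hu hq0 hn]
  have hr0 : 0 < r := hr.1.lt_of_ne (by rintro rfl; rw [h.zero] at hry; exact hy.ne hry)
  have hp : posInv φ y = r := by
    refine posInv_eq_of_unique hr0 hry fun q hq0 hq => ?_
    rcases lt_trichotomy q r with hlt | heq | hgt
    · linarith [h.strictMono_of_theta0_lt hu (key q hq0 hq) hlt]
    · exact heq
    · linarith [h.strictMono_of_theta0_lt hu (key r hr0 hry) hgt]
  rw [hp]
  exact ⟨key r hr0 hry, hry⟩

lemma posInv_deriv_spec (h : IsConvexExponent φ) (hu : DerivUnbounded φ) {y a : ℝ} (ha : 0 < a)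
    (hy : deriv φ a < y) : a < posInv (deriv φ) y ∧ deriv φ (posInv (deriv φ) y) = y := by
  obtain ⟨s, has, hs0, hs⟩ := hu y a
  have hc : ContinuousOn (deriv φ) (Icc a s) := fun x hx =>
    (h.hasDerivAt_deriv x (ha.trans_le hx.1)).continuousAt.continuousWithinAt
  obtain ⟨r, hr, hry⟩ := intermediate_value_Icc has.le hc ⟨hy.le, hs.le⟩
  have hr0 : 0 < r := ha.trans_le hr.1
  have hp : posInv (deriv φ) y = r := by
    refine posInv_eq_of_unique hr0 hry fun q hq0 hq => ?_
    rcases lt_trichotomy q r with hlt | heq | hgt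
    · linarith [h.deriv_strictMono hq0 hlt]
    · exact heq
    · linarith [h.deriv_strictMono hr0 hgt]
  rw [hp]
  exact ⟨hr.1.lt_of_ne (by rintro rfl; exact hy.ne hry), hry⟩

/-- With `m` the midpoint of `[θ₀, r]`, one has `φ(r) ≥ φ'(m) (r - θ₀)/2`, and decrease of `φ''`
gives `φ'(r) ≤ 3 φ'(m)`. Since `r - θ₀ ≥ r/2`, the constant is `3 · 2 · 2`. -/
lemma mul_deriv_le (h : IsConvexExponent φ) (hu : DerivUnbounded φ) {r : ℝ} (hr : theta0 φ < r)
    (hr2 : 2 * theta0 φ ≤ r) : r * deriv φ r ≤ 12 * φ r := by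
  have h0 := (h.theta0_mem hu).1
  set θ := theta0 φ with hθ
  have hm : θ < (θ + r) / 2 := by linarith
  have hm' : θ < (3 * θ + r) / 4 := by linarith
  have h1 := h.le_sub (a := (θ + r) / 2) (b := r) (by linarith) (by linarith)
  have h2 := h.pos_of_theta0_lt hu hm
  have h3 := h.deriv_sub_le (a := (θ + r) / 2) (b := r) (by linarith) (by linarith)
  have h4 := h.le_deriv_sub (a := (3 * θ + r) / 4) (b := (θ + r) / 2) (by linarith) (by linarith)
  have h5 := h.deriv_pos_of_theta0_lt hu hm'
  have h6 := h.deriv_pos_of_theta0_lt hu hm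
  have h7 : deriv φ r ≤ 3 * deriv φ ((θ + r) / 2) := by nlinarith
  nlinarith

/-- Decrease of `φ''` gives `φ'(2r) ≤ φ'(r) + r φ''(r)`, and on `[(θ₀ + r)/2, r]` it gives `r φ''(r)
≤ 4 φ'(r)`. -/
lemma deriv_two_mul_le (h : IsConvexExponent φ) (hu : DerivUnbounded φ) {r : ℝ}
    (hr : theta0 φ < r) (hr2 : 2 * theta0 φ ≤ r) : deriv φ (2 * r) ≤ 5 * deriv φ r := by
  have h0 := (h.theta0_mem hu).1
  set θ := theta0 φ with hθ
  have hm : θ < (θ + r) / 2 := by linarith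
  have h3 := h.deriv_sub_le (a := r) (b := 2 * r) (by linarith) (by linarith)
  have h4 := h.le_deriv_sub (a := (θ + r) / 2) (b := r) (by linarith) (by linarith)
  have h5 := h.deriv_pos_of_theta0_lt hu hm
  have h6 := h.deriv2_pos r (by linarith)
  nlinarith

/-- Read downwards, scaling says `φ''(u) ≤ c⁻¹ (u/w)^(α-2) φ''(w)`, whose integral up to `w`
converges at `0` as `α > 1`. The integration is done by the mean value theorem for `k (u/w)^(α-1) -
φ'(u)`. -/
lemma deriv_sub_le_of_wlsc (h : IsConvexExponent φ) {α c x₀ : ℝ} (hα : 1 < α) (hc : 0 < c)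
    (hx₀ : 0 ≤ x₀) (hs : WLSC (deriv (deriv φ)) (α - 2) c x₀) {s w : ℝ} (hxs : x₀ < s)
    (hsw : s ≤ w) : deriv φ w - deriv φ s ≤ (c * (α - 1))⁻¹ * (w * deriv (deriv φ) w) := by
  have hα1 : 0 < α - 1 := by linarith
  have hs0 : 0 < s := hx₀.trans_lt hxs
  have hw0 : 0 < w := hs0.trans_le hsw
  have hgw := h.deriv2_pos w hw0
  rcases hsw.eq_or_lt with rfl | hsw
  · rw [sub_self]; positivity
  set k := (c * (α - 1))⁻¹ * (w * deriv (deriv φ) w) with hk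
  have hk0 : 0 < k := by positivity
  have hd : ∀ u, 0 < u → HasDerivAt (fun u => k * (u / w) ^ (α - 1) - deriv φ u)
      (k * (1 / w * (α - 1) * (u / w) ^ (α - 1 - 1)) - deriv (deriv φ) u) u := by
    intro u hu
    refine (((hasDerivAt_id u).div_const w).rpow_const (p := α - 1) (Or.inl ?_)).const_mul k |>.sub
      (h.hasDerivAt_deriv u hu)
    simp only [id]
    positivity
  obtain ⟨u, hu, he⟩ := exists_hasDerivAt_eq_slope (fun u => k * (u / w) ^ (α - 1) - deriv φ u) _ hsw
    (fun u hu => (hd u (hs0.trans_le hu.1)).continuousAt.continuousWithinAt)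
    (fun u hu => hd u (hs0.trans hu.1))
  have hu0 : 0 < u := hs0.trans hu.1
  have hge : 0 ≤ k * (1 / w * (α - 1) * (u / w) ^ (α - 1 - 1)) - deriv (deriv φ) u := by
    have h1 := hs.le_of_le hx₀ (hxs.trans hu.1) hu.2.le
    rw [show α - 1 - 1 = α - 2 by ring, ← inv_div w u, Real.inv_rpow (by positivity)]
    have h2 : 0 < (w / u) ^ (α - 2) := by positivity
    have e : k * (1 / w * (α - 1) * ((w / u) ^ (α - 2))⁻¹) =
        deriv (deriv φ) w / (c * (w / u) ^ (α - 2)) := by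
      rw [hk]; field_simp
    rw [e, sub_nonneg, le_div_iff₀ (by positivity)]
    linarith
  rw [he, div_self hw0.ne', Real.one_rpow, le_div_iff₀ (by linarith)] at hge
  have : 0 ≤ k * (s / w) ^ (α - 1) := by positivity
  linarith

/-- The increment bound must start where `φ'` is under control. For `x₀ = 0` this is `θ₁`, where
`φ'` vanishes; for `x₀ > 0` it is `2 x₀`, whose value of `φ'` is absorbed because `w φ''(w)` is
bounded below. -/
lemma exists_deriv_le (h : IsConvexExponent φ) {α c x₀ : ℝ} (hα : 1 < α) (hc : 0 < c)
    (hx₀ : 0 ≤ x₀) (hs : WLSC (deriv (deriv φ)) (α - 2) c x₀)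
    (hθ₁ : HasDerivWithinAt φ 0 (Ici 0) (theta1 φ)) :
    ∃ D : ℝ, 0 < D ∧ ∀ w, 0 < w → 2 * x₀ ≤ w → deriv φ w ≤ D * (w * deriv (deriv φ) w) := by
  have hα1 : 0 < α - 1 := by linarith
  set C := (c * (α - 1))⁻¹ with hC
  have hC0 : 0 < C := by positivity
  rcases hx₀.eq_or_lt with rfl | hx0
  · refine ⟨C, hC0, fun w hw _ => ?_⟩
    have hgw := h.deriv2_pos w hw
    rcases le_or_gt (deriv φ w) 0 with hn | hp
    · exact hn.trans (by positivity)
    have hθ0 : 0 ≤ theta1 φ := Real.sInf_nonneg fun s hs => hs.1.le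
    have hθw : theta1 φ ≤ w := csInf_le ⟨0, fun s hs => hs.1.le⟩ ⟨hw, hp⟩
    rcases hθ0.eq_or_lt with he | hlt
    -- For `θ₁ = 0` the hypothesis concerns difference quotients at `0`; the mean value theorem
    -- converts it into points `ξ` with `φ'(ξ) < η`.
    · refine le_of_forall_pos_le_add fun η hη => ?_
      rw [← he] at hθ₁
      have hsl := hasDerivWithinAt_iff_tendsto_slope.1 hθ₁
      have hsub : Ioi (0 : ℝ) ⊆ Ici 0 \ {0} := fun q (hq : 0 < q) => ⟨hq.le, hq.ne'⟩
      have hev := (hsl.eventually_lt_const hη).filter_mono (nhdsWithin_mono 0 hsub)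
      obtain ⟨s, hs1, hs2⟩ := (hev.and (Ioo_mem_nhdsGT hw)).exists
      obtain ⟨ξ, hξ, hξe⟩ := h.exists_slope le_rfl hs2.1
      have hξη : deriv φ ξ < η := by
        rw [slope_def_field, hξe, mul_div_cancel_right₀ _ (by linarith [hs2.1])] at hs1
        exact hs1
      have := h.deriv_sub_le_of_wlsc hα hc le_rfl hs hξ.1 (hξ.2.trans hs2.2).le
      linarith
    · have h0 : deriv φ (theta1 φ) = 0 := (hθ₁.hasDerivAt (Ici_mem_nhds hlt)).deriv
      have := h.deriv_sub_le_of_wlsc hα hc le_rfl hs hlt hθw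
      linarith
  · set x := 2 * x₀ with hx
    have hxp : 0 < x := by positivity
    have hgx := h.deriv2_pos x hxp
    refine ⟨C + |deriv φ x| / (c * x * deriv (deriv φ) x), by positivity, fun w hw hxw => ?_⟩
    have h1 := h.deriv_sub_le_of_wlsc hα hc hx₀ hs (by linarith : x₀ < x) hxw
    have h2 := hs.le_of_le hx₀ (by linarith : x₀ < x) hxw
    have hr : 1 ≤ w / x := (one_le_div hxp).2 hxw
    have h3 : c * x * deriv (deriv φ) x ≤ w * deriv (deriv φ) w := by
      calc c * x * deriv (deriv φ) x = c * x * 1 * deriv (deriv φ) x := by ring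
        _ ≤ c * x * (w / x) ^ (α - 1) * deriv (deriv φ) x := by
            gcongr; exact Real.one_le_rpow hr hα1.le
        _ = w * (c * (w / x) ^ (α - 2) * deriv (deriv φ) x) := by
            rw [show α - 1 = 1 + (α - 2) by ring, Real.rpow_add (by positivity), Real.rpow_one]
            field_simp
        _ ≤ _ := by gcongr
    have h4 : |deriv φ x| ≤ |deriv φ x| / (c * x * deriv (deriv φ) x) * (w * deriv (deriv φ) w) := by
      rw [div_mul_eq_mul_div, le_div_iff₀ (by positivity)]
      gcongr
    have h5 := le_abs_self (deriv φ x)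
    rw [add_mul]
    linarith

end IsConvexExponent

/-! ### Transfer of the analytic properties to the Laplace exponent of the process -/

section Paths

variable {Ω : Type*} [MeasurableSpace Ω] {P : Measure Ω} [IsProbabilityMeasure P]
  {X : ℝ≥0 → Ω → ℝ} {σ b : ℝ} {ν : Measure ℝ}

lemma IsSpectrallyPositiveLevy.eventuallyEq_lkReal (hX : IsSpectrallyPositiveLevy X P σ b ν)
    {s : ℝ} (hs : 0 < s) : laplaceExponent X P =ᶠ[𝓝 s] lkReal σ b (ν.restrict (Ioi 0)) := by
  filter_upwards [Ioi_mem_nhds hs] with r hr using hX.laplaceExponent_eq (le_of_lt hr)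

lemma IsSpectrallyPositiveLevy.deriv_laplaceExponent (hX : IsSpectrallyPositiveLevy X P σ b ν)
    {s : ℝ} (hs : 0 < s) :
    deriv (laplaceExponent X P) s = lkDeriv σ b (ν.restrict (Ioi 0)) s := by
  rw [(hX.eventuallyEq_lkReal hs).deriv_eq]
  exact (hasDerivAt_lkReal σ b hX.levyMeasure.isLevyOnPos hs).deriv

lemma IsSpectrallyPositiveLevy.eventuallyEq_lkDeriv (hX : IsSpectrallyPositiveLevy X P σ b ν)
    {s : ℝ} (hs : 0 < s) :
    deriv (laplaceExponent X P) =ᶠ[𝓝 s] lkDeriv σ b (ν.restrict (Ioi 0)) := by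
  filter_upwards [Ioi_mem_nhds hs] with r hr using hX.deriv_laplaceExponent hr

lemma IsSpectrallyPositiveLevy.deriv2_laplaceExponent (hX : IsSpectrallyPositiveLevy X P σ b ν)
    {s : ℝ} (hs : 0 < s) :
    deriv (deriv (laplaceExponent X P)) s = lkDeriv2 σ (ν.restrict (Ioi 0)) s := by
  rw [(hX.eventuallyEq_lkDeriv hs).deriv_eq]
  exact (hasDerivAt_lkDeriv σ b hX.levyMeasure.isLevyOnPos hs).deriv

lemma IsSpectrallyPositiveLevy.isConvexExponent (hX : IsSpectrallyPositiveLevy X P σ b ν)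
    (hvar : UnboundedVariation X P) : IsConvexExponent (laplaceExponent X P) := by
  have hρ := hX.levyMeasure.isLevyOnPos
  refine ⟨?_, ?_, ?_, ?_, ?_, ?_⟩
  · exact (continuousOn_lkReal σ b hρ).congr fun s hs => hX.laplaceExponent_eq hs
  · rw [hX.laplaceExponent_eq le_rfl, lkReal_zero]
  · intro s hs
    rw [hX.deriv_laplaceExponent hs]
    exact (hasDerivAt_lkReal σ b hρ hs).congr_of_eventuallyEq (hX.eventuallyEq_lkReal hs)
  · intro s hs
    rw [hX.deriv2_laplaceExponent hs]
    exact (hasDerivAt_lkDeriv σ b hρ hs).congr_of_eventuallyEq (hX.eventuallyEq_lkDeriv hs)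
  · intro s hs
    rw [hX.deriv2_laplaceExponent hs]
    exact hX.lkDeriv2_pos hvar hs
  · intro s r hs hsr
    rw [hX.deriv2_laplaceExponent hs, hX.deriv2_laplaceExponent (hs.trans_le hsr)]
    exact lkDeriv2_antitone σ hρ hs hsr

end Paths

/-! ### The saddle point approximation -/

lemma norm_cexp_sub_cexp_le {a b : ℂ} {M : ℝ} (ha : a.re ≤ M) (hb : b.re ≤ M) :
    ‖Complex.exp a - Complex.exp b‖ ≤ Real.exp M * ‖a - b‖ := by
  refine (convex_halfSpace_re_le M).norm_image_sub_le_of_norm_hasDerivWithin_le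
    (f := Complex.exp) (f' := Complex.exp) (fun z _ => (Complex.hasDerivAt_exp z).hasDerivWithinAt)
    (fun z hz => ?_) hb ha
  rw [Complex.norm_exp, Real.exp_le_exp]
  exact hz

/-- A majorant for the error in the saddle point approximation. -/
noncomputable def saddleMajorant (K κ v : ℝ) : ℝ :=
  K * (|v| ^ 3 * Real.exp (-κ * v ^ 2)) + 2 * (|v| * Real.exp (-κ * |v|))

lemma integrable_saddleMajorant (K : ℝ) {κ : ℝ} (hκ : 0 < κ) : Integrable (saddleMajorant K κ) := by
  have h1 : Integrable fun v : ℝ => |v| ^ 3 * Real.exp (-κ * v ^ 2) := by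
    have := (integrable_rpow_mul_exp_neg_mul_sq hκ (s := ((3 : ℕ) : ℝ)) (by norm_num)).norm
    refine this.congr (Eventually.of_forall fun v => ?_)
    simp only [Real.rpow_natCast, norm_mul, norm_pow, Real.norm_eq_abs, Real.abs_exp]
  have h2 : Integrable fun v : ℝ => |v| * Real.exp (-κ * |v|) := by
    refine ((integrable_exp_neg_mul_abs (a := κ / 2) (by positivity)).const_mul (κ / 2)⁻¹).mono'
      (by fun_prop) (Eventually.of_forall fun v => ?_)
    rw [Real.norm_of_nonneg (by positivity)]
    have h := mul_exp_neg_le (x := |v|) (d := κ / 2) (by positivity)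
    calc |v| * Real.exp (-κ * |v|)
        = (|v| * Real.exp (-(κ / 2 * |v|))) * Real.exp (-(κ / 2) * |v|) := by
          rw [mul_assoc, ← Real.exp_add]; congr 2; ring
      _ ≤ _ := by gcongr
  exact (h1.const_mul K).add (h2.const_mul 2)

/-- Pointwise comparison of the integrand on the saddle line with a Gaussian. -/
lemma norm_saddle_sub_gaussian_le {σ b : ℝ} {ρ : Measure ℝ} (hρ : IsLevyOnPos ρ) {κ Q w t s : ℝ}
    (hκ0 : 0 < κ) (hκ2 : κ ≤ 1 / 2) (hw : 0 < w) (ht : 0 < t) (hQ0 : 0 ≤ Q)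
    (hs0 : 0 < s) (hs : s ^ 2 = t * lkDeriv2 σ ρ w) (hm : 1 ≤ s * w)
    (hQ : lkDeriv2 σ ρ (w / 2) ≤ Q * lkDeriv2 σ ρ w)
    (hin : ∀ u, |u| ≤ w → κ * u ^ 2 * lkDeriv2 σ ρ w ≤ lkEnergy σ ρ w u)
    (hout : ∀ u, w ≤ |u| → κ * (w * |u|) * lkDeriv2 σ ρ w ≤ lkEnergy σ ρ w u) (u : ℝ) :
    ‖Complex.exp (t * (lkExp σ b ρ (w + u * Complex.I) - lkReal σ b ρ w -
        Complex.I * u * lkDeriv σ b ρ w)) - Real.exp (-(s ^ 2 / 2) * u ^ 2)‖ ≤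
      (s * w)⁻¹ * saddleMajorant (8 * Q) κ (u * s) := by
  set a : ℂ := t * (lkExp σ b ρ (w + u * Complex.I) - lkReal σ b ρ w -
        Complex.I * u * lkDeriv σ b ρ w) with ha
  have hare : a.re = -(t * lkEnergy σ ρ w u) := by
    rw [ha, Complex.re_ofReal_mul, Complex.sub_re, Complex.sub_re, re_lkExp_vertical σ b hρ hw.le]
    simp [lkEnergy]
    ring
  have hav : |u * s| = |u| * s := by rw [abs_mul, abs_of_pos hs0]
  rw [Complex.ofReal_exp]
  set d : ℂ := ((-(s ^ 2 / 2) * u ^ 2 : ℝ) : ℂ) with hd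
  have hdre : d.re = -(s ^ 2 / 2) * u ^ 2 := Complex.ofReal_re _
  have hm0 : 0 < s * w := by positivity
  unfold saddleMajorant
  rcases le_total |u| w with hu | hu
  -- Near the saddle both exponents have real part at most `-κ (u s)²`, and they differ by the cubic
  -- Taylor error.
  · have h1 : a.re ≤ -κ * (u * s) ^ 2 := by
      rw [hare, mul_pow, hs]
      have := mul_le_mul_of_nonneg_left (hin u hu) ht.le
      linarith
    have h2 : d.re ≤ -κ * (u * s) ^ 2 := by
      rw [hdre]; nlinarith [sq_nonneg (u * s)]
    refine (norm_cexp_sub_cexp_le h1 h2).trans ?_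
    have h3 : ‖a - d‖ ≤ (s * w)⁻¹ * (8 * Q * |u * s| ^ 3) := by
      have e : a - d = t * (lkExp σ b ρ (w + u * Complex.I) - lkReal σ b ρ w -
          Complex.I * u * lkDeriv σ b ρ w + (u : ℂ) ^ 2 / 2 * lkDeriv2 σ ρ w) := by
        rw [ha, hd, hs]; push_cast; ring
      rw [e, norm_mul, Complex.norm_real, Real.norm_of_nonneg ht.le]
      calc _ ≤ t * (8 * |u| ^ 3 / w * (Q * lkDeriv2 σ ρ w)) := by
            gcongr
            refine (lkExp_third_order σ b hρ hw u).trans ?_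
            gcongr
        _ = 8 * Q * |u| ^ 3 * s ^ 2 / w := by rw [hs]; ring
        _ = _ := by rw [hav]; field_simp
    calc _ ≤ Real.exp (-κ * (u * s) ^ 2) * ((s * w)⁻¹ * (8 * Q * |u * s| ^ 3)) := by gcongr
      _ = (s * w)⁻¹ * (8 * Q * (|u * s| ^ 3 * Real.exp (-κ * (u * s) ^ 2))) := by ring
      _ ≤ _ := by
          gcongr
          exact le_add_of_nonneg_right (by positivity)
  -- Far from the saddle each term is small separately, at most `exp (-κ |u s|)` as `s w ≥ 1`; the
  -- factor `|u s| / (s w) ≥ 1` is then inserted.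
  · have hmv : s * w ≤ |u * s| := by rw [hav, mul_comm]; gcongr
    have h1 : a.re ≤ -κ * |u * s| := by
      rw [hare, hav]
      have h := mul_le_mul_of_nonneg_left (hout u hu) ht.le
      have e : t * (κ * (w * |u|) * lkDeriv2 σ ρ w) = κ * (|u| * s) * (s * w) := by
        calc _ = κ * (w * |u|) * (t * lkDeriv2 σ ρ w) := by ring
          _ = _ := by rw [← hs]; ring
      rw [e] at h
      have h2 : κ * (|u| * s) * 1 ≤ κ * (|u| * s) * (s * w) := by gcongr
      linarith
    have h2 : d.re ≤ -κ * |u * s| := by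
      rw [hdre]
      have h3 : |u * s| * 1 ≤ |u * s| * |u * s| := by gcongr; linarith
      have h4 : |u * s| * |u * s| = u ^ 2 * s ^ 2 := by rw [abs_mul_abs_self]; ring
      nlinarith [abs_nonneg (u * s)]
    have hone : 1 ≤ (s * w)⁻¹ * |u * s| := by
      rw [← div_eq_inv_mul]; exact (one_le_div hm0).2 hmv
    calc _ ≤ ‖Complex.exp a‖ + ‖Complex.exp d‖ := norm_sub_le _ _
      _ ≤ Real.exp (-κ * |u * s|) + Real.exp (-κ * |u * s|) := by
          rw [Complex.norm_exp, Complex.norm_exp]; gcongr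
      _ = 1 * (2 * Real.exp (-κ * |u * s|)) := by ring
      _ ≤ ((s * w)⁻¹ * |u * s|) * (2 * Real.exp (-κ * |u * s|)) := by gcongr
      _ = (s * w)⁻¹ * (2 * (|u * s| * Real.exp (-κ * |u * s|))) := by ring
      _ ≤ _ := by
          gcongr
          exact le_add_of_nonneg_left (by positivity)

/-- Substituting `v = u s`, the error is at most the integral of the majorant divided by `s (s w)`,
hence at most `1 / s` under `hm2`, against a main term `√(2π) / s`. -/
lemma norm_integral_saddle_sub_le {σ b : ℝ} {ρ : Measure ℝ} (hρ : IsLevyOnPos ρ) {κ Q w t s : ℝ}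
    (hκ0 : 0 < κ) (hκ2 : κ ≤ 1 / 2) (hw : 0 < w) (ht : 0 < t) (hQ0 : 0 ≤ Q)
    (hs0 : 0 < s) (hs : s ^ 2 = t * lkDeriv2 σ ρ w) (hm : 1 ≤ s * w)
    (hm2 : ∫ v, saddleMajorant (8 * Q) κ v ≤ s * w)
    (hQ : lkDeriv2 σ ρ (w / 2) ≤ Q * lkDeriv2 σ ρ w)
    (hin : ∀ u, |u| ≤ w → κ * u ^ 2 * lkDeriv2 σ ρ w ≤ lkEnergy σ ρ w u)
    (hout : ∀ u, w ≤ |u| → κ * (w * |u|) * lkDeriv2 σ ρ w ≤ lkEnergy σ ρ w u) :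
    ‖(∫ u : ℝ, Complex.exp (t * (lkExp σ b ρ (w + u * Complex.I) - lkReal σ b ρ w -
        Complex.I * u * lkDeriv σ b ρ w))) - ((√(2 * Real.pi) / s : ℝ) : ℂ)‖ ≤ 1 / s := by
  set f : ℝ → ℂ := fun u => Complex.exp (t * (lkExp σ b ρ (w + u * Complex.I) - lkReal σ b ρ w -
        Complex.I * u * lkDeriv σ b ρ w)) with hf
  set g : ℝ → ℂ := fun u => ((Real.exp (-(s ^ 2 / 2) * u ^ 2) : ℝ) : ℂ) with hg
  have hle : ∀ u, ‖f u - g u‖ ≤ (s * w)⁻¹ * saddleMajorant (8 * Q) κ (u * s) :=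
    norm_saddle_sub_gaussian_le hρ hκ0 hκ2 hw ht hQ0 hs0 hs hm hQ hin hout
  have hMi : Integrable fun u => (s * w)⁻¹ * saddleMajorant (8 * Q) κ (u * s) :=
    ((integrable_comp_mul_right_iff _ hs0.ne').2 (integrable_saddleMajorant _ hκ0)).const_mul _
  have hgi : Integrable g := (integrable_exp_neg_mul_sq (b := s ^ 2 / 2) (by positivity)).ofReal
  have hfc : Continuous f := by
    have hc : Continuous fun u : ℝ => lkExp σ b ρ (w + u * Complex.I) := by
      refine (continuousOn_lkExp σ b hρ).comp_continuous (by fun_prop) fun u => ?_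
      simpa using hw.le
    simp only [hf]
    fun_prop
  have hgc : Continuous g := by simp only [hg]; fun_prop
  have hfgi : Integrable fun u => f u - g u :=
    hMi.mono' (hfc.sub hgc).aestronglyMeasurable (Eventually.of_forall hle)
  have hfi : Integrable f := by
    refine (hfgi.add hgi).congr (Eventually.of_forall fun u => ?_)
    simp
  have hgauss : ∫ u, g u = ((√(2 * Real.pi) / s : ℝ) : ℂ) := by
    rw [hg, integral_complex_ofReal, integral_gaussian]
    congr 1
    rw [show Real.pi / (s ^ 2 / 2) = 2 * Real.pi / s ^ 2 by field_simp,
      Real.sqrt_div (by positivity), Real.sqrt_sq hs0.le]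
  rw [← hgauss, ← integral_sub hfi hgi]
  calc _ ≤ ∫ u, (s * w)⁻¹ * saddleMajorant (8 * Q) κ (u * s) :=
        norm_integral_le_of_norm_le hMi (Eventually.of_forall hle)
    _ = (s * w)⁻¹ * (s⁻¹ * ∫ v, saddleMajorant (8 * Q) κ v) := by
        rw [integral_const_mul, Measure.integral_comp_mul_right, smul_eq_mul,
          abs_of_pos (inv_pos.2 hs0)]
    _ ≤ (s * w)⁻¹ * (s⁻¹ * (s * w)) := by gcongr
    _ = 1 / s := by field_simp

/-- The inversion formula on the saddle line. -/
lemma invCharFun_saddle {σ b : ℝ} {ρ : Measure ℝ} (hρ : IsLevyOnPos ρ) {t w : ℝ} (hw : 0 ≤ w)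
    (hd : StripDecay fun z => Complex.exp (t * lkExp σ b ρ z)) :
    invCharFun (fun ξ : ℝ => Complex.exp (t * lkExp σ b ρ (-(ξ * Complex.I))))
        (-t * lkDeriv σ b ρ w) =
      (((2 * Real.pi)⁻¹ * Real.exp (-t * (w * lkDeriv σ b ρ w - lkReal σ b ρ w)) : ℝ) : ℂ) *
        ∫ u : ℝ, Complex.exp (t * (lkExp σ b ρ (w + u * Complex.I) - lkReal σ b ρ w -
        Complex.I * u * lkDeriv σ b ρ w)) := by
  have h := invCharFun_shift (halfPlaneHolo_exp_lkExp σ b hρ t) hd hw (-t * lkDeriv σ b ρ w)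
  rw [h, invCharFun, mul_left_comm, ← integral_const_mul, ← integral_neg_eq_self,
    Complex.ofReal_mul (2 * Real.pi)⁻¹, mul_assoc,
    ← integral_const_mul ((Real.exp (-t * (w * lkDeriv σ b ρ w - lkReal σ b ρ w)) : ℝ) : ℂ)]
  congr 1
  · push_cast; rfl
  · congr 1
    ext u
    push_cast
    rw [← Complex.exp_add, ← Complex.exp_add, ← Complex.exp_add]
    congr 1
    rw [show (w : ℂ) - -u * Complex.I = w + u * Complex.I by ring]
    ring

/-- Two-sided bounds for the density on the saddle line. -/
lemma saddle_bounds {σ b : ℝ} {ρ : Measure ℝ} (hρ : IsLevyOnPos ρ) {κ Q w t s : ℝ}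
    (hκ0 : 0 < κ) (hκ2 : κ ≤ 1 / 2) (hw : 0 < w) (ht : 0 < t) (hQ0 : 0 ≤ Q)
    (hs0 : 0 < s) (hs : s ^ 2 = t * lkDeriv2 σ ρ w) (hm : 1 ≤ s * w)
    (hm2 : ∫ v, saddleMajorant (8 * Q) κ v ≤ s * w)
    (hQ : lkDeriv2 σ ρ (w / 2) ≤ Q * lkDeriv2 σ ρ w)
    (hin : ∀ u, |u| ≤ w → κ * u ^ 2 * lkDeriv2 σ ρ w ≤ lkEnergy σ ρ w u)
    (hout : ∀ u, w ≤ |u| → κ * (w * |u|) * lkDeriv2 σ ρ w ≤ lkEnergy σ ρ w u)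
    (hd : StripDecay fun z => Complex.exp (t * lkExp σ b ρ z)) :
    (7 : ℝ)⁻¹ * (1 / s * Real.exp (-t * (w * lkDeriv σ b ρ w - lkReal σ b ρ w))) ≤
      (invCharFun (fun ξ : ℝ => Complex.exp (t * lkExp σ b ρ (-(ξ * Complex.I))))
        (-t * lkDeriv σ b ρ w)).re ∧
    (invCharFun (fun ξ : ℝ => Complex.exp (t * lkExp σ b ρ (-(ξ * Complex.I))))
        (-t * lkDeriv σ b ρ w)).re ≤
      7 * (1 / s * Real.exp (-t * (w * lkDeriv σ b ρ w - lkReal σ b ρ w))) := by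
  have hmain := norm_integral_saddle_sub_le (b := b) hρ hκ0 hκ2 hw ht hQ0 hs0 hs hm hm2 hQ hin hout
  rw [invCharFun_saddle hρ hw.le hd, Complex.re_ofReal_mul]
  generalize (∫ u : ℝ, Complex.exp (t * (lkExp σ b ρ (w + u * Complex.I) - lkReal σ b ρ w -
        Complex.I * u * lkDeriv σ b ρ w))) = I at hmain
  generalize he : Real.exp (-t * (w * lkDeriv σ b ρ w - lkReal σ b ρ w)) = e
  have he0 : 0 < e := he ▸ Real.exp_pos _
  have hIre : |I.re - √(2 * Real.pi) / s| ≤ 1 / s := by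
    have := (Complex.abs_re_le_norm _).trans hmain
    rwa [Complex.sub_re, Complex.ofReal_re] at this
  rw [abs_le] at hIre
  -- As `2 ≤ √(2π) ≤ 3`, an error `1 / s` leaves the integral between `1 / s` and `4 / s`; the
  -- constant `7` comes from `2π < 7`.
  have hpi2 : 2 ≤ √(2 * Real.pi) := Real.le_sqrt_of_sq_le (by nlinarith [Real.pi_gt_three])
  have hpi3 : √(2 * Real.pi) ≤ 3 := Real.sqrt_le_iff.2 ⟨by norm_num, by nlinarith [Real.pi_lt_four]⟩
  have hlow : 1 / s ≤ I.re := by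
    have : 2 / s ≤ √(2 * Real.pi) / s := by gcongr
    have e : 2 / s = 1 / s + 1 / s := by ring
    linarith [hIre.1]
  have hup : I.re ≤ 4 / s := by
    have : √(2 * Real.pi) / s ≤ 3 / s := by gcongr
    have e : 4 / s = 3 / s + 1 / s := by ring
    linarith [hIre.2]
  have hpil : (7 : ℝ)⁻¹ ≤ (2 * Real.pi)⁻¹ := by gcongr; linarith [Real.pi_lt_d2]
  have hpiu : (2 * Real.pi)⁻¹ ≤ 1 := inv_le_one_of_one_le₀ (by linarith [Real.pi_gt_three])
  have hs1 : 0 < 1 / s := by positivity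
  constructor
  · calc (7 : ℝ)⁻¹ * (1 / s * e) = 7⁻¹ * e * (1 / s) := by ring
      _ ≤ (2 * Real.pi)⁻¹ * e * I.re := by gcongr
  · calc (2 * Real.pi)⁻¹ * e * I.re ≤ 1 * e * (4 / s) := by gcongr; exact hs1.le.trans hlow
      _ = 4 * (1 / s * e) := by ring
      _ ≤ 7 * (1 / s * e) := by gcongr; norm_num

/-! ### Location of the saddle point and conclusion -/

/-- In the range of the main theorem, the saddle point lies beyond twice `φ⁻¹(1/t)`, and the
saddle point approximation is in its asymptotic regime. -/
lemma IsConvexExponent.saddle_point_spec {φ : ℝ → ℝ} (hE : IsConvexExponent φ)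
    (hu : IsConvexExponent.DerivUnbounded φ) {x₀ D J t x : ℝ} (hD : 0 < D)
    (hDw : ∀ w, 0 < w → 2 * x₀ ≤ w → deriv φ w ≤ D * (w * deriv (deriv φ) w))
    (ht0 : 0 < t) (hM : max 60 (D * J ^ 2) < -x * posInv φ (1 / t))
    (hle1 : t * φ (max x₀ (2 * theta0 φ)) ≤ 1) :
    0 < posInv (deriv φ) (-x / t) ∧ 2 * x₀ < posInv (deriv φ) (-x / t) ∧
      deriv φ (posInv (deriv φ) (-x / t)) = -x / t ∧
      J ≤ √(t * deriv (deriv φ) (posInv (deriv φ) (-x / t))) * posInv (deriv φ) (-x / t) := by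
  obtain ⟨hrθ, hr⟩ := hE.posInv_spec hu (y := 1 / t) (by positivity)
  set r := posInv φ (1 / t) with hrd
  obtain ⟨hθ0, -⟩ := hE.theta0_mem hu
  have hr0 : 0 < r := hθ0.trans_lt hrθ
  have htr : t * φ r = 1 := by rw [hr]; field_simp
  -- Otherwise strict monotonicity beyond `θ₀` would give `t φ(max) > t φ(r) = 1`.
  have hmax : max x₀ (2 * theta0 φ) ≤ r := by
    by_contra! hlt
    have := hE.strictMono_of_theta0_lt hu hrθ hlt
    nlinarith
  have hxr : x₀ ≤ r := (le_max_left _ _).trans hmax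
  have hθr : 2 * theta0 φ ≤ r := (le_max_right _ _).trans hmax
  have hM60 : 60 < -x * r := (le_max_left _ _).trans_lt hM
  have hMD : D * J ^ 2 < -x * r := (le_max_right _ _).trans_lt hM
  have hx0 : 0 < -x := by
    by_contra! hn
    nlinarith
  have hlt : deriv φ (2 * r) < -x / t := by
    have h1 := hE.mul_deriv_le hu hrθ hθr
    have h2 := hE.deriv_two_mul_le hu hrθ hθr
    rw [lt_div_iff₀ ht0]
    have h3 : r * (deriv φ (2 * r) * t) ≤ 60 := by
      calc r * (deriv φ (2 * r) * t) ≤ r * (5 * deriv φ r * t) := by gcongr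
        _ = 5 * (r * deriv φ r) * t := by ring
        _ ≤ 5 * (12 * φ r) * t := by gcongr
        _ = 60 * (t * φ r) := by ring
        _ = 60 := by rw [htr, mul_one]
    by_contra! hn
    nlinarith
  obtain ⟨hrw, hwx⟩ := hE.posInv_deriv_spec hu (by positivity) hlt
  set w := posInv (deriv φ) (-x / t)
  have hw0 : 0 < w := by linarith
  have hg0 : 0 < t * deriv (deriv φ) w := mul_pos ht0 (hE.deriv2_pos w hw0)
  set s := √(t * deriv (deriv φ) w) with hsd
  have hs0 : 0 < s := Real.sqrt_pos.2 hg0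
  have hs2 : s ^ 2 = t * deriv (deriv φ) w := Real.sq_sqrt hg0.le
  refine ⟨hw0, by linarith, hwx, ?_⟩
  refine le_of_sq_le_sq ?_ (by positivity)
  -- Here `-x w` is bounded below by `-x r > D J²` and above by `D (s w)²`, through `-x = t φ'(w)`.
  have h1 := hDw w hw0 (by linarith)
  rw [hwx, div_le_iff₀ ht0] at h1
  have h2 : -x * r ≤ -x * w := by gcongr; linarith
  have h3 : -x * w ≤ D * (s * w) ^ 2 := by
    rw [mul_pow, hs2]
    calc -x * w ≤ D * (w * deriv (deriv φ) w) * t * w := by gcongr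
      _ = _ := by ring
  exact le_of_mul_le_mul_left (by linarith) hD

end SpecPos

open SpecPos in
theorem corollary6 {Ω : Type*} [MeasurableSpace Ω] (P : Measure Ω) [IsProbabilityMeasure P]
    (X : ℝ≥0 → Ω → ℝ) (σ b : ℝ) (ν : Measure ℝ)
    (hX : SpecPos.IsSpectrallyPositiveLevy X P σ b ν)
    (hvar : SpecPos.UnboundedVariation X P)
    (φ : ℝ → ℝ) (hφ : φ = SpecPos.laplaceExponent X P)
    (α c x₀ : ℝ) (hα : 1 < α) (hc : 0 < c) (hc' : c ≤ 1) (hx₀ : 0 ≤ x₀)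
    (hscal : SpecPos.WLSC (deriv (deriv φ)) (α - 2) c x₀)
    -- `φ'(θ₁) = 0`, a one-sided derivative if `θ₁ = 0`
    (hθ₁ : HasDerivWithinAt φ 0 (Ici 0) (SpecPos.theta1 φ)) :
    ∃ p : ℝ≥0 → ℝ → ℝ,
      (∀ t, 0 < t → SpecPos.IsContinuousDensity (P.map (X t)) (p t)) ∧
      ∃ M : ℝ, 0 < M ∧ ∃ C : ℝ, 1 ≤ C ∧
        ∀ (t : ℝ≥0) (x w : ℝ), 0 < t →
          M < -x * SpecPos.posInv φ (1 / t) →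
          0 ≤ t * φ (max x₀ (2 * SpecPos.theta0 φ)) →
          t * φ (max x₀ (2 * SpecPos.theta0 φ)) ≤ 1 →
          w = SpecPos.posInv (deriv φ) (-x / t) →
          (0 < w ∧ deriv φ w = -x / t) ∧
          C⁻¹ * SpecPos.saddleValue φ t w ≤ p t x ∧ p t x ≤ C * SpecPos.saddleValue φ t w := by
  have hρ := hX.levyMeasure.isLevyOnPos
  have hφ0 : ∀ s, 0 ≤ s → φ s = lkReal σ b (ν.restrict (Ioi 0)) s := fun s hs => by
    rw [hφ, hX.laplaceExponent_eq hs]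
  have hφ1 : ∀ s, 0 < s → deriv φ s = lkDeriv σ b (ν.restrict (Ioi 0)) s := fun s hs => by
    rw [hφ, hX.deriv_laplaceExponent hs]
  have hφ2 : ∀ s, 0 < s → deriv (deriv φ) s = lkDeriv2 σ (ν.restrict (Ioi 0)) s := fun s hs => by
    rw [hφ, hX.deriv2_laplaceExponent hs]
  have hE : IsConvexExponent φ := hφ ▸ hX.isConvexExponent hvar
  set ρ := ν.restrict (Ioi 0) with hρd
  have hs : WLSC (lkDeriv2 σ ρ) (α - 2) c x₀ := by
    intro l x hl hx
    have hx0 : 0 < x := hx₀.trans_lt hx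
    have := hscal l x hl hx
    rwa [hφ2 x hx0, hφ2 (l * x) (by positivity)] at this
  have hpos : ∀ s, 0 < s → 0 < lkDeriv2 σ ρ s := fun s hs0 => hX.lkDeriv2_pos hvar hs0
  have hu := hE.derivUnbounded hα hc hx₀ hscal
  have hdecay : ∀ t : ℝ, 0 < t → StripDecay fun z => Complex.exp (t * lkExp σ b ρ z) :=
    fun t ht => stripDecay_exp_lkExp hρ hα hc hx₀ hs hpos ht
  have hcf : ∀ t : ℝ≥0, charFun (P.map (X t)) =
      fun ξ : ℝ => Complex.exp ((t : ℝ) * lkExp σ b ρ (-(ξ * Complex.I))) :=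
    fun t => funext fun ξ => hX.charFun_lk t ξ
  have hprob : ∀ t, IsProbabilityMeasure (P.map (X t)) := fun t =>
    Measure.isProbabilityMeasure_map (hX.measurable t).aemeasurable
  have hdens : ∀ t : ℝ≥0, 0 < t → IsContinuousDensity (P.map (X t))
      fun x => (invCharFun (charFun (P.map (X t))) x).re := by
    intro t ht
    refine (isContinuousDensity_of_integrable_charFun (P.map (X t)) ?_).1
    rw [hcf t]
    have := (StripDecay.integrable_vertical (halfPlaneHolo_exp_lkExp σ b hρ t)
      (hdecay t ht) le_rfl).comp_neg
    refine this.congr (Eventually.of_forall fun ξ => ?_)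
    simp
  refine ⟨fun t x => (invCharFun (charFun (P.map (X t))) x).re, hdens, ?_⟩
  obtain ⟨κ', hκ', hin', hout'⟩ := exists_lkEnergy_bounds hρ hα hc hx₀ hs
  obtain ⟨D, hD, hDw⟩ := hE.exists_deriv_le hα hc hx₀ hscal hθ₁
  -- The cap `1/2` makes the comparison Gaussian `exp (-s² u² / 2)` obey the same decay bounds as
  -- the integrand.
  set κ := min κ' (1 / 2) with hκ
  have hκ0 : 0 < κ := by positivity
  set Q : ℝ := (c * 2 ^ (α - 2))⁻¹ with hQ
  have hQ0 : 0 ≤ Q := by positivity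
  set J := max 1 (∫ v, saddleMajorant (8 * Q) κ v) with hJ
  have hJ1 : 1 ≤ J := le_max_left _ _
  -- `60` puts the saddle beyond `2 φ⁻¹(1/t)`; `D J²` yields `s w ≥ J`, which covers both `s w ≥ 1`
  -- and the bound on the integrated majorant.
  refine ⟨max 60 (D * J ^ 2), lt_max_of_lt_left (by norm_num), 7, by norm_num, ?_⟩
  intro t x w ht hM _ hle1 hw
  have ht0 : (0 : ℝ) < t := ht
  have hw1 := hE.saddle_point_spec hu hD hDw ht0 hM hle1
  rw [← hw] at hw1
  obtain ⟨hw0, hwx0, hwx, hm⟩ := hw1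
  refine ⟨⟨hw0, hwx⟩, ?_⟩
  have hg0 : 0 < t * deriv (deriv φ) w := mul_pos ht0 (hE.deriv2_pos w hw0)
  have hκκ : κ ≤ κ' := min_le_left _ _
  have hgl := lkDeriv2_nonneg σ ρ w
  have hxe : x = -(t : ℝ) * lkDeriv σ b ρ w := by
    rw [← hφ1 w hw0, hwx]; field_simp
  have hb := saddle_bounds (b := b) hρ (κ := κ) (Q := Q) hκ0 (min_le_right _ _) hw0 ht0 hQ0
    (Real.sqrt_pos.2 hg0) (by rw [Real.sq_sqrt hg0.le, hφ2 w hw0]) (hJ1.trans hm)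
    ((le_max_right _ _).trans hm) (hs.half_le hc hx₀ hwx0)
    (fun u hu => le_trans (by gcongr) (hin' w u (by linarith) hu))
    (fun u hu => le_trans (by gcongr) (hout' w w u hw0.le (by linarith) hu hu)) (hdecay t ht0)
  rw [← hxe, ← hφ1 w hw0, ← hφ0 w hw0.le, ← hcf t] at hb
  exact hb
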